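/- **Setting.** For a bounded Lipschitz domain $\Omega\subset\mathbb R^3$ let $C_P=C_P(\Omega)$ be the smallest constant $C\in[0,\infty]$ with $\|w\|_{L^2(\Omega)}\le C\|\nabla w\|_{L^2(\Omega)}$ for all $w\in H^1(\Omega)$ with $\frac1{|\Omega|}\int_\Omega w\,dx=0$. For a plane set $\Gamma\subset\mathbb R^2$ whose copy $\Gamma\times\{0\}$ is a part of $\partial\Omega$, let $C_\Gamma=C_\Gamma(\Omega)$ be the smallest constant $C\in[0,\infty]$ with $\|w\|_{L^2(\Omega)}\le C\|\nabla w\|_{L^2(\Omega)}$ for all $w\in H^1(\Omega)$ whose trace on $\Gamma\times\{0\}$ has zero mean, $\langle w\rangle_\Gamma=\frac1{|\Gamma|}\int_\Gamma w\,ds=0$. **Statement.** (i) Let $\Gamma\subset\mathbb R^2$, $H:\mathbb R^2\to\mathbb R$ and $H_{\min}>0$ be such that $H\ge H_{\min}$ on $\Gamma$ and the prismatic cell $$\Omega=\{x\in\mathbb R^3 : (x_1,x_2)\in\Gamma,\ 0<x_3<H(x_1,x_2)\}$$ is a bounded Lipschitz domain. Put $\langle H\rangle_\Gamma=\frac1{|\Gamma|}\int_\Gamma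 H$ and $\kappa=\left(\frac{\langle H\rangle_\Gamma}{H_{\min}}-1\right)^{1/2}$. Then $$C_\Gamma^2\le C_P^2+\left(\frac{\langle H\rangle_\Gamma}{\sqrt3}+C_P\,\kappa\right)^2 .$$ (ii) In particular, if $H>0$ is constant and $\Gamma\subset\mathbb R^2$ is a non-empty bounded open convex set with diameter $d_\Gamma$, then $$C_\Gamma^2\le\frac{d_\Gamma^2+H^2}{\pi^2}+\frac{H^2}{3}=\frac1{\pi^2}\left(d_\Gamma^2+\Bigl(1+\frac{\pi^2}{3}\Bigr)H^2\right).$$ -/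

import Mathlib

open MeasureTheory Filter Topology
open scoped ENNReal NNReal ContDiff

noncomputable section

/-- Bounded Lipschitz domain in `ℝⁿ`: a bounded, connected (in particular non-empty) open set that,
near each of its boundary points and in suitable orthogonal coordinates, is the set of points
strictly above the graph of a Lipschitz function. Here `ν` is the unit vector of the vertical
direction, and `x - ⟪ν, x⟫ ν` is the horizontal part of `x`. -/
def IsLipschitzDomain {n : ℕ} (Ω : Set (EuclideanSpace ℝ (Fin n))) : Prop :=
  IsOpen Ω ∧ IsConnected Ω ∧ Bornology.IsBounded Ω ∧
    ∀ p ∈ frontier Ω, ∃ (ν : EuclideanSpace ℝ (Fin n)) (K : ℝ≥0)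
      (g : EuclideanSpace ℝ (Fin n) → ℝ) (r : ℝ),
      ‖ν‖ = 1 ∧ LipschitzWith K g ∧ 0 < r ∧
        ∀ x ∈ Metric.ball p r,
          (x ∈ Ω ↔ g (x - (inner ℝ ν x) • ν) < inner ℝ ν x)

/-- `G` is the weak gradient of `w` in the open set `Ω`. -/
def HasWeakGradient {n : ℕ} (Ω : Set (EuclideanSpace ℝ (Fin n)))
    (w : EuclideanSpace ℝ (Fin n) → ℝ)
    (G : EuclideanSpace ℝ (Fin n) → EuclideanSpace ℝ (Fin n)) : Prop :=
  ∀ φ : EuclideanSpace ℝ (Fin n) → ℝ, ContDiff ℝ ∞ φ → HasCompactSupport φ → tsupport φ ⊆ Ω →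
    ∀ i : Fin n,
      ∫ x in Ω, w x * fderiv ℝ φ x (EuclideanSpace.single i 1) = - ∫ x in Ω, G x i * φ x

/-- `w` belongs to `H¹(Ω)` and `G` is its weak gradient. -/
def IsH1 {n : ℕ} (Ω : Set (EuclideanSpace ℝ (Fin n)))
    (w : EuclideanSpace ℝ (Fin n) → ℝ)
    (G : EuclideanSpace ℝ (Fin n) → EuclideanSpace ℝ (Fin n)) : Prop :=
  MemLp w 2 (volume.restrict Ω) ∧ MemLp G 2 (volume.restrict Ω) ∧ HasWeakGradient Ω w G

/-- The constant `C_P(Ω)`: the smallest `C ∈ [0, ∞]` with `‖w‖ ≤ C ‖∇w‖` (norms of `L²(Ω)`)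
for all `w ∈ H¹(Ω)` with zero mean in `Ω`. -/
def poincareConst {n : ℕ} (Ω : Set (EuclideanSpace ℝ (Fin n))) : ℝ≥0∞ :=
  sInf {C : ℝ≥0∞ | ∀ (w : EuclideanSpace ℝ (Fin n) → ℝ)
    (G : EuclideanSpace ℝ (Fin n) → EuclideanSpace ℝ (Fin n)),
    IsH1 Ω w G → ⨍ x in Ω, w x = 0 →
      eLpNorm w 2 (volume.restrict Ω) ≤ C * eLpNorm G 2 (volume.restrict Ω)}

/-- The projection `(x₁, x₂, x₃) ↦ (x₁, x₂)`. -/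
def horizontal (x : EuclideanSpace ℝ (Fin 3)) : EuclideanSpace ℝ (Fin 2) := !₂[x 0, x 1]

/-- The embedding `(y₁, y₂) ↦ (y₁, y₂, 0)` of the plane onto `{x₃ = 0}`. -/
def onBase (y : EuclideanSpace ℝ (Fin 2)) : EuclideanSpace ℝ (Fin 3) := !₂[y 0, y 1, 0]

/-- The (open) prismatic domain over `Γ` with height `H`. -/
def prism (Γ : Set (EuclideanSpace ℝ (Fin 2))) (H : EuclideanSpace ℝ (Fin 2) → ℝ) :
    Set (EuclideanSpace ℝ (Fin 3)) :=
  {x | horizontal x ∈ Γ ∧ 0 < x 2 ∧ x 2 < H (horizontal x)}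

/-- `g ∈ L²(Γ)` is the trace on the flat face `Γ × {0}` of the function `w ∈ H¹(Ω)` with weak
gradient `G`: it is the `L²(Γ)`-limit of the restrictions to the face of functions that are smooth
up to the boundary and converge to `w` in `H¹(Ω)`. -/
def IsBaseTrace (Ω : Set (EuclideanSpace ℝ (Fin 3))) (Γ : Set (EuclideanSpace ℝ (Fin 2)))
    (w : EuclideanSpace ℝ (Fin 3) → ℝ)
    (G : EuclideanSpace ℝ (Fin 3) → EuclideanSpace ℝ (Fin 3))
    (g : EuclideanSpace ℝ (Fin 2) → ℝ) : Prop :=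
  MemLp g 2 (volume.restrict Γ) ∧
  ∃ φ : ℕ → EuclideanSpace ℝ (Fin 3) → ℝ,
    (∀ k, ContDiff ℝ ∞ (φ k)) ∧
    Tendsto (fun k => eLpNorm (fun x => φ k x - w x) 2 (volume.restrict Ω)) atTop (𝓝 0) ∧
    Tendsto (fun k => eLpNorm (fun x => gradient (φ k) x - G x) 2 (volume.restrict Ω))
      atTop (𝓝 0) ∧
    Tendsto (fun k => eLpNorm (fun y => φ k (onBase y) - g y) 2 (volume.restrict Γ))
      atTop (𝓝 0)

/-- The constant `C_Γ(Ω)` of the boundary Poincaré inequality, for the face `Γ × {0}`: the smallest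
`C ∈ [0, ∞]` with `‖w‖ ≤ C ‖∇w‖` (norms of `L²(Ω)`) for all `w ∈ H¹(Ω)` whose trace on the face has
zero mean. -/
def boundaryPoincareConst (Ω : Set (EuclideanSpace ℝ (Fin 3)))
    (Γ : Set (EuclideanSpace ℝ (Fin 2))) : ℝ≥0∞ :=
  sInf {C : ℝ≥0∞ | ∀ (w : EuclideanSpace ℝ (Fin 3) → ℝ)
    (G : EuclideanSpace ℝ (Fin 3) → EuclideanSpace ℝ (Fin 3))
    (g : EuclideanSpace ℝ (Fin 2) → ℝ),
    IsH1 Ω w G → IsBaseTrace Ω Γ w G g → ⨍ y in Γ, g y = 0 →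
      eLpNorm w 2 (volume.restrict Ω) ≤ C * eLpNorm G 2 (volume.restrict Ω)}

end

/-! Part (i) rests on one identity. On the vertical fibre over `y`, the derivative of `-(1 - z / H)
φ` is `φ / H - (1 - z / H) ∂₃φ`; integrating over the fibre and then over `Γ` expresses the base
integral of `φ` through two integrals over the prism (`setIntegral_base_eq`), and both sides pass to
the limit along the approximations that define the trace (`IsBaseTrace.setIntegral_eq`). Let `m` be
the mean of `w` on `Ω`, `V = |Ω|`, `A = |Γ|`, so `⟨H⟩ = V / A`. If the trace has zero mean, then `A
m = ∫ (1 - x₃ / H) G₃ - ∫ (1 / H - A / V) (w - m)`, where `1 / H` may be centred because `w - m` has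
zero mean. By Cauchy–Schwarz, with `‖1 - x₃ / H‖² = V / 3`, `‖1 / H - A / V‖² ≤ (A² / V) κ²` and the
Poincaré inequality for `w - m`, one gets `√V |m| ≤ (⟨H⟩ / √3 + C κ) ‖G‖`. Then `‖w‖² = ‖w - m‖² + V
m²` gives the claim (`boundary_poincare_of_poincare`).

In part (ii) `κ = 0`, and it remains to prove the Poincaré inequality on a convex cylinder with
squared constant `(d² + H²) / π²` (`poincare_cylinder`). The sharp inequality on each vertical fibre
leaves the square of the fibre integral, a function on `Γ` with zero mean, to which the planar
Payne–Weinberger inequality applies. Only functions with a base trace occur, and these come with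
smooth approximations.

Payne–Weinberger (`payne_weinberger`) is proved by bisection. If the inequality fails, a line
through any prescribed point cuts the set into two convex pieces on which `f` still has zero mean,
and it fails on one of them by the same margin per unit area. Cutting through a dense sequence of
points leaves arbitrarily thin pieces (`exists_thin_of_cutting`). There `f` is almost a function of
one coordinate, and the one-dimensional inequality whose weight is the length of the sections, a
concave function, gives a contradiction (`poincare_thin`).

That weighted inequality (`weighted_poincare_Icc`) is dual to a Wirtinger inequality with weight `1
/ p` for the primitive of the centred function times `p` (`wirtinger_of_concave_weight`). The latter
is a completed square built from the cotangent and `p' / p`; concavity enters through the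
monotonicity of `p' / p`. -/

/-! ### The sharp Poincaré inequality on an interval with concave weight -/

/-- One step of integration by parts against a monotone multiplier, on a single interval. -/
theorem antitone_mul_sub_le_integral_mul_deriv {s t B : ℝ} (hst : s ≤ t) {m w w' : ℝ → ℝ}
    (hm : AntitoneOn m (Set.Icc s t)) (hw : ∀ x ∈ Set.Icc s t, 0 ≤ w x)
    (hwc : ContinuousOn w (Set.Icc s t))
    (hw' : ∀ x ∈ Set.Ioo s t, HasDerivWithinAt w (w' x) (Set.Ioi x) x)
    (hint : IntervalIntegrable w' volume s t)
    (hmint : IntervalIntegrable (fun x => m x * w' x) volume s t)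
    (hB : ∀ x ∈ Set.Icc s t, |w' x| ≤ B) :
    m t * w t - m s * w s - B * (t - s) * (m s - m t) ≤ ∫ x in s..t, m x * w' x := by
  have hs : s ∈ Set.Icc s t := ⟨le_rfl, hst⟩
  have ht : t ∈ Set.Icc s t := ⟨hst, le_rfl⟩
  have hFTC : ∫ x in s..t, w' x = w t - w s :=
    intervalIntegral.integral_eq_sub_of_hasDeriv_right_of_le hst hwc hw' hint
  have hB0 : 0 ≤ B := (abs_nonneg _).trans (hB s hs)
  -- Freezing `m` at the left end makes the integral exact, at the price of the oscillation of `m`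
  -- times `B`.
  have h1 : ∫ x in s..t, (m x * w' x - m s * w' x) = (∫ x in s..t, m x * w' x) - m s * (w t - w s) := by
    rw [intervalIntegral.integral_sub hmint (hint.const_mul _), intervalIntegral.integral_const_mul, hFTC]
  have h2 : |∫ x in s..t, (m x * w' x - m s * w' x)| ≤ (B * (m s - m t)) * |t - s| := by
    rw [← Real.norm_eq_abs]
    refine intervalIntegral.norm_integral_le_of_norm_le_const fun x hx => ?_
    rw [Set.uIoc_of_le hst] at hx
    have hx' : x ∈ Set.Icc s t := ⟨hx.1.le, hx.2⟩
    have e1 := hm hs hx' hx'.1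
    have e2 := hm hx' ht hx'.2
    rw [← sub_mul, Real.norm_eq_abs, abs_mul, mul_comm]
    have : |m x - m s| ≤ m s - m t := by rw [abs_le]; constructor <;> linarith
    exact mul_le_mul (hB x hx') this (abs_nonneg _) hB0
  rw [abs_of_nonneg (sub_nonneg.2 hst)] at h2
  have h3 := (abs_le.1 h2).1
  rw [h1] at h3
  have h4 : 0 ≤ (m s - m t) * w t := mul_nonneg (sub_nonneg.2 (hm hs ht hst)) (hw t ht)
  nlinarith

/-- `∫ m w' ≥ 0` for antitone `m` and non-negative `w` vanishing at both ends. -/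
theorem integral_antitone_mul_deriv_nonneg {a b B : ℝ} (hab : a ≤ b) {m w w' : ℝ → ℝ}
    (hm : AntitoneOn m (Set.Icc a b)) (hw : ∀ x ∈ Set.Icc a b, 0 ≤ w x)
    (hwc : ContinuousOn w (Set.Icc a b))
    (hw' : ∀ x ∈ Set.Ioo a b, HasDerivWithinAt w (w' x) (Set.Ioi x) x)
    (hint : IntervalIntegrable w' volume a b)
    (hmint : IntervalIntegrable (fun x => m x * w' x) volume a b)
    (hB : ∀ x ∈ Set.Icc a b, |w' x| ≤ B) (hwa : w a = 0) (hwb : w b = 0) :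
    0 ≤ ∫ x in a..b, m x * w' x := by
  -- Cut into `N + 1` equal pieces. Both the main terms and the errors telescope: the former vanish
  -- with `w` at the ends, the latter add up to mesh size times the total drop of `m`.
  have key : ∀ N : ℕ, -(B * ((b - a) / (N + 1)) * (m a - m b)) ≤ ∫ x in a..b, m x * w' x := by
    intro N
    set h : ℝ := (b - a) / (N + 1) with hh
    have hN : (0 : ℝ) < N + 1 := by positivity
    have h0 : 0 ≤ h := div_nonneg (sub_nonneg.2 hab) hN.le
    set x : ℕ → ℝ := fun i => a + i * h with hx
    have hxN : x (N + 1) = b := by simp only [hx, hh]; push_cast; field_simp; ring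
    have hx0 : x 0 = a := by simp [hx]
    have hmono : Monotone x := fun i j hij => by
      simp only [hx]; have : (i : ℝ) ≤ j := by exact_mod_cast hij
      nlinarith
    have hsub : ∀ i, i < N + 1 → Set.Icc (x i) (x (i + 1)) ⊆ Set.Icc a b := fun i hi =>
      Set.Icc_subset_Icc (hx0 ▸ hmono (Nat.zero_le i)) (hxN ▸ hmono (Nat.succ_le_of_lt hi))
    have hle : ∀ i, x i ≤ x (i + 1) := fun i => hmono (Nat.le_succ i)
    have hsubu : ∀ i, i < N + 1 → Set.uIcc (x i) (x (i + 1)) ⊆ Set.uIcc a b := fun i hi => by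
      rw [Set.uIcc_of_le hab, Set.uIcc_of_le (hle i)]; exact hsub i hi
    have hsum := intervalIntegral.sum_integral_adjacent_intervals (μ := volume)
      (f := fun y => m y * w' y) (a := x) (n := N + 1) fun i hi => hmint.mono_set (hsubu i hi)
    rw [hx0, hxN] at hsum
    rw [← hsum]
    have hstep : ∀ i ∈ Finset.range (N + 1),
        (m (x (i + 1)) * w (x (i + 1)) - m (x i) * w (x i)) + B * h * (m (x (i + 1)) - m (x i)) ≤
          ∫ y in x i..x (i + 1), m y * w' y := by
      intro i hi
      have hi := Finset.mem_range.1 hi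
      have hIoo : Set.Ioo (x i) (x (i + 1)) ⊆ Set.Ioo a b :=
        Set.Ioo_subset_Ioo (hx0 ▸ hmono (Nat.zero_le i)) (hxN ▸ hmono (Nat.succ_le_of_lt hi))
      have := antitone_mul_sub_le_integral_mul_deriv (hle i) (hm.mono (hsub i hi))
        (fun y hy => hw y (hsub i hi hy)) (hwc.mono (hsub i hi))
        (fun y hy => hw' y (hIoo hy)) (hint.mono_set (hsubu i hi)) (hmint.mono_set (hsubu i hi))
        (fun y hy => hB y (hsub i hi hy))
      have e : x (i + 1) - x i = h := by simp only [hx]; push_cast; ring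
      rw [e] at this
      linarith
    refine le_trans (le_of_eq ?_) (Finset.sum_le_sum hstep)
    rw [Finset.sum_add_distrib, ← Finset.mul_sum, Finset.sum_range_sub (fun i => m (x i) * w (x i)),
      Finset.sum_range_sub (fun i => m (x i)), hx0, hxN, hwa, hwb]
    ring
  have hlim : Tendsto (fun N : ℕ => -(B * ((b - a) / ((N : ℝ) + 1)) * (m a - m b))) atTop (𝓝 0) := by
    have h1 : Tendsto (fun N : ℕ => (b - a) / ((N : ℝ) + 1)) atTop (𝓝 0) := by
      have := tendsto_one_div_add_atTop_nhds_zero_nat (𝕜 := ℝ)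
      simpa [div_eq_mul_inv] using this.const_mul (b - a)
    simpa using ((h1.const_mul B).mul_const (m a - m b)).neg
  exact le_of_tendsto' hlim key

/-- The logarithmic derivative of a positive concave function, taken from the right, is antitone. -/
theorem exists_antitone_log_rightDeriv {a b : ℝ} {p : ℝ → ℝ} (hp : ConcaveOn ℝ (Set.Ioo a b) p)
    (hpos : ∀ x ∈ Set.Ioo a b, 0 < p x) :
    ∃ m : ℝ → ℝ, AntitoneOn m (Set.Ioo a b) ∧
      ∀ x ∈ Set.Ioo a b, HasDerivWithinAt p (m x * p x) (Set.Ioi x) x := by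
  have hint : interior (Set.Ioo a b) = Set.Ioo a b := interior_Ioo
  have hg : ConvexOn ℝ (Set.Ioo a b) (-p) := hp.neg
  set D : ℝ → ℝ := fun x => derivWithin (-p) (Set.Ioi x) x with hD
  have hDmono : MonotoneOn D (Set.Ioo a b) := by
    have := hg.monotoneOn_rightDeriv
    rwa [hint] at this
  refine ⟨fun x => -D x / p x, ?_, fun x hx => ?_⟩
  · intro x hx y hy hxy
    rcases hxy.eq_or_lt with rfl | hlt
    · exact le_rfl
    have h1 : D x ≤ slope (-p) x y := hg.rightDeriv_le_slope_of_mem_interior (by rwa [hint]) hy hlt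
    have h2 : slope (-p) x y ≤ D y :=
      (hg.slope_le_leftDeriv_of_mem_interior hx (by rwa [hint]) hlt).trans
        (hg.leftDeriv_le_rightDeriv_of_mem_interior (by rwa [hint]))
    have h3 := hDmono hx hy hxy
    rw [slope_def_field, le_div_iff₀ (sub_pos.2 hlt)] at h1
    rw [slope_def_field, div_le_iff₀ (sub_pos.2 hlt)] at h2
    simp only [Pi.neg_apply] at h1 h2
    have px := hpos x hx
    have py := hpos y hy
    have hd := sub_pos.2 hlt
    show -D y / p y ≤ -D x / p x
    rw [div_le_div_iff₀ py px]
    -- `D` is the right derivative of `-p`, so its sign tells whether `p` falls or rises from `x` to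
    -- `y`; in each case numerator and denominator push the quotient the same way.
    rcases le_total 0 (D x) with h | h
    · have : p y ≤ p x := by nlinarith
      nlinarith
    · rcases le_total 0 (D y) with h' | h'
      · nlinarith
      · have : p x ≤ p y := by nlinarith
        nlinarith
  · have := (hg.hasDerivWithinAt_rightDeriv_of_mem_interior (x := x) (by rwa [hint])).neg
    rw [neg_neg] at this
    exact this.congr_deriv (div_mul_cancel₀ _ (hpos x hx).ne').symm

/-- A sharp Wirtinger inequality with weight `1 / p`, where `p` is concave and positive on an open
interval containing `[s, t]`. -/
theorem wirtinger_of_concave_weight {a b s t : ℝ} (has : a < s) (hst : s ≤ t) (htb : t < b)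
    {p q q' : ℝ → ℝ} (hp : ConcaveOn ℝ (Set.Ioo a b) p) (hpos : ∀ x ∈ Set.Ioo a b, 0 < p x)
    (hq : ∀ x ∈ Set.Ioo s t, HasDerivAt q (q' x) x) (hqc : ContinuousOn q (Set.Icc s t))
    (hq' : ContinuousOn q' (Set.Icc s t)) (hqs : q s = 0) (hqt : q t = 0) :
    (Real.pi / (b - a)) ^ 2 * ∫ x in s..t, q x ^ 2 / p x ≤ ∫ x in s..t, q' x ^ 2 / p x := by
  obtain ⟨m, hm, hpd⟩ := exists_antitone_log_rightDeriv hp hpos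
  set k := Real.pi / (b - a) with hk
  have hba : 0 < b - a := by linarith
  have hkpos : 0 < k := div_pos Real.pi_pos hba
  have hsub : Set.Icc s t ⊆ Set.Ioo a b := fun x hx => ⟨has.trans_le hx.1, hx.2.trans_lt htb⟩
  have hsub' : Set.Ioo s t ⊆ Set.Icc s t := Set.Ioo_subset_Icc_self
  have hu : Set.uIcc s t = Set.Icc s t := Set.uIcc_of_le hst
  have hpc : ContinuousOn p (Set.Icc s t) := (hp.continuousOn isOpen_Ioo).mono hsub
  have hp0 : ∀ x ∈ Set.Icc s t, p x ≠ 0 := fun x hx => (hpos x (hsub hx)).ne'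
  have hmI : AntitoneOn m (Set.Icc s t) := hm.mono hsub
  set w : ℝ → ℝ := fun x => q x ^ 2 / p x with hw
  set v : ℝ → ℝ := fun x => 2 * q x * q' x / p x with hv
  have hwc : ContinuousOn w (Set.Icc s t) := (hqc.pow 2).div hpc hp0
  have hvc : ContinuousOn v (Set.Icc s t) := ((continuousOn_const.mul hqc).mul hq').div hpc hp0
  have hw0 : ∀ x ∈ Set.Icc s t, 0 ≤ w x := fun x hx => div_nonneg (sq_nonneg _) (hpos x (hsub hx)).le
  have hwd : ∀ x ∈ Set.Ioo s t, HasDerivWithinAt w (v x - m x * w x) (Set.Ioi x) x := by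
    intro x hx
    have h1 := ((hq x hx).hasDerivWithinAt (s := Set.Ioi x)).fun_pow 2
    refine (h1.fun_div (hpd x (hsub (hsub' hx))) (hp0 x (hsub' hx))).congr_deriv ?_
    have := hp0 x (hsub' hx)
    simp only [hv, hw]
    field_simp
    try ring
  -- `m` is bounded and integrable
  obtain ⟨A, hA⟩ : ∃ A, ∀ x ∈ Set.Icc s t, |m x| ≤ A := by
    refine ⟨max |m s| |m t|, fun x hx => ?_⟩
    have h1 := hmI ⟨le_rfl, hst⟩ hx hx.1
    have h2 := hmI hx ⟨hst, le_rfl⟩ hx.2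
    exact (abs_le_max_abs_abs h2 h1).trans (by rw [max_comm])
  have hmint : IntervalIntegrable m volume s t := AntitoneOn.intervalIntegrable (by rwa [hu])
  have hmm : IntervalIntegrable (fun x => m x * m x) volume s t := by
    rw [intervalIntegrable_iff_integrableOn_Ioc_of_le hst] at hmint ⊢
    refine Integrable.bdd_mul (c := A) hmint hmint.aestronglyMeasurable ?_
    exact (ae_restrict_mem measurableSet_Ioc).mono fun x hx => hA x ⟨hx.1.le, hx.2⟩
  have hvi : IntervalIntegrable v volume s t := ContinuousOn.intervalIntegrable (by rwa [hu])
  have hmw : IntervalIntegrable (fun x => m x * w x) volume s t := hmint.mul_continuousOn (by rwa [hu])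
  have hmv : IntervalIntegrable (fun x => m x * v x) volume s t := hmint.mul_continuousOn (by rwa [hu])
  have hmmw : IntervalIntegrable (fun x => m x * m x * w x) volume s t :=
    hmm.mul_continuousOn (by rwa [hu])
  have hw'i : IntervalIntegrable (fun x => v x - m x * w x) volume s t := hvi.sub hmw
  have hmw'i : IntervalIntegrable (fun x => m x * (v x - m x * w x)) volume s t := by
    refine (hmv.sub hmmw).congr (fun x _ => ?_)
    show m x * v x - m x * m x * w x = _
    ring
  have hws : w s = 0 := by simp [hw, hqs]
  have hwt : w t = 0 := by simp [hw, hqt]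
  obtain ⟨Bv, hBv⟩ := isCompact_Icc.exists_bound_of_continuousOn hvc
  obtain ⟨Bw, hBw⟩ := isCompact_Icc.exists_bound_of_continuousOn hwc
  -- This is `∫ m w'`, with `w = q² / p` and `w' = v - m w`.
  have hpart : 0 ≤ ∫ x in s..t, m x * (v x - m x * w x) := by
    refine integral_antitone_mul_deriv_nonneg (B := Bv + A * Bw) hst hmI hw0 hwc hwd hw'i hmw'i ?_ hws hwt
    intro x hx
    have h1 := hBv x hx
    have h2 := hBw x hx
    have h3 := hA x hx
    rw [Real.norm_eq_abs] at h1 h2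
    calc |v x - m x * w x| ≤ |v x| + |m x * w x| := abs_sub _ _
      _ ≤ _ := by
        rw [abs_mul]
        exact add_le_add h1 (mul_le_mul h3 h2 (abs_nonneg _) ((abs_nonneg _).trans h3))
  -- the cotangent
  set c : ℝ → ℝ := fun x => k * Real.cos (k * (x - a)) / Real.sin (k * (x - a)) with hc
  have hsin : ∀ x ∈ Set.Icc s t, 0 < Real.sin (k * (x - a)) := by
    intro x hx
    have hx' := hsub hx
    refine Real.sin_pos_of_pos_of_lt_pi (mul_pos hkpos (sub_pos.2 hx'.1)) ?_
    calc k * (x - a) < k * (b - a) := by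
          apply mul_lt_mul_of_pos_left _ hkpos; linarith [hx'.2]
      _ = Real.pi := by rw [hk]; field_simp
  -- The Riccati equation of `k cot (k (x - a))`. The poles are at `a` and `b`, outside `[s, t]`,
  -- which is why `k = π / (b - a)` is admissible.
  have hcd : ∀ x ∈ Set.Icc s t, HasDerivAt c (-k ^ 2 - c x ^ 2) x := by
    intro x hx
    have h0 : HasDerivAt (fun x => k * (x - a)) k x := by
      simpa using ((hasDerivAt_id x).sub_const a).const_mul k
    have h1 := (h0.cos.const_mul k).fun_div h0.sin (hsin x hx).ne'
    refine h1.congr_deriv ?_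
    have := (hsin x hx).ne'
    simp only [hc]
    field_simp
  have hcc : ContinuousOn c (Set.Icc s t) := fun x hx => (hcd x hx).continuousAt.continuousWithinAt
  have hcwd : ∀ x ∈ Set.Ioo s t, HasDerivWithinAt (fun x => c x * w x)
      ((-k ^ 2 - c x ^ 2) * w x + c x * (v x - m x * w x)) (Set.Ioi x) x := fun x hx =>
    ((hcd x (hsub' hx)).hasDerivWithinAt).fun_mul (hwd x hx)
  have hcwi : IntervalIntegrable
      (fun x => (-k ^ 2 - c x ^ 2) * w x + c x * (v x - m x * w x)) volume s t := by
    refine IntervalIntegrable.add (ContinuousOn.intervalIntegrable ?_)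
      (hw'i.continuousOn_mul (by rwa [hu]))
    rw [hu]; exact (continuousOn_const.sub (hcc.pow 2)).mul hwc
  have hFTC : ∫ x in s..t, ((-k ^ 2 - c x ^ 2) * w x + c x * (v x - m x * w x)) = 0 := by
    rw [intervalIntegral.integral_eq_sub_of_hasDeriv_right_of_le hst (hcc.mul hwc) hcwd hcwi]
    simp [hws, hwt]
  have hwi : IntervalIntegrable w volume s t := ContinuousOn.intervalIntegrable (by rwa [hu])
  have hq'i : IntervalIntegrable (fun x => q' x ^ 2 / p x) volume s t := by
    refine ContinuousOn.intervalIntegrable ?_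
    rw [hu]; exact (hq'.pow 2).div hpc hp0
  have hcmp : ∫ x in s..t, ((1 / 2) * (m x * (v x - m x * w x)) +
      ((-k ^ 2 - c x ^ 2) * w x + c x * (v x - m x * w x))) ≤
      ∫ x in s..t, (q' x ^ 2 / p x - k ^ 2 * w x) := by
    refine intervalIntegral.integral_mono_on hst ((hmw'i.const_mul _).add hcwi)
      (hq'i.sub (hwi.const_mul _)) fun x hx => ?_
    have hpx := hpos x (hsub hx)
    -- The pointwise difference of the two integrands is exactly this square plus `m² w / 4`.
    have h1 : 0 ≤ (q' x - (m x / 2 + c x) * q x) ^ 2 / p x + m x ^ 2 / 4 * w x :=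
      add_nonneg (div_nonneg (sq_nonneg _) hpx.le) (mul_nonneg (by positivity) (hw0 x hx))
    rw [← sub_nonneg]
    convert h1 using 1
    simp only [hw, hv]
    field_simp
    ring
  rw [intervalIntegral.integral_add (hmw'i.const_mul _) hcwi, intervalIntegral.integral_const_mul,
    hFTC, intervalIntegral.integral_sub hq'i (hwi.const_mul _), intervalIntegral.integral_const_mul] at hcmp
  linarith

/-- The sharp Poincaré inequality on a compact subinterval, with a concave weight. -/
theorem weighted_poincare_Icc {a b s t : ℝ} (has : a < s) (hst : s < t) (htb : t < b)
    {p f f' : ℝ → ℝ} (hp : ConcaveOn ℝ (Set.Ioo a b) p) (hpos : ∀ x ∈ Set.Ioo a b, 0 < p x)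
    (hf : ∀ x, HasDerivAt f (f' x) x) (hf' : Continuous f') :
    ∫ x in s..t, f x ^ 2 * p x ≤ ((b - a) / Real.pi) ^ 2 * (∫ x in s..t, f' x ^ 2 * p x) +
      (∫ x in s..t, f x * p x) ^ 2 / ∫ x in s..t, p x := by
  have hba : 0 < b - a := by linarith
  have hsub : Set.Icc s t ⊆ Set.Ioo a b := fun x hx => ⟨has.trans_le hx.1, hx.2.trans_lt htb⟩
  have hu : Set.uIcc s t = Set.Icc s t := Set.uIcc_of_le hst.le
  have hpc : ContinuousOn p (Set.Ioo a b) := hp.continuousOn isOpen_Ioo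
  have hpI : ContinuousOn p (Set.Icc s t) := hpc.mono hsub
  have hfc : Continuous f := continuous_iff_continuousAt.2 fun x => (hf x).continuousAt
  have ii : ∀ {g : ℝ → ℝ}, ContinuousOn g (Set.Icc s t) → IntervalIntegrable g volume s t :=
    fun hg => ContinuousOn.intervalIntegrable (by rwa [hu])
  have hP : 0 < ∫ x in s..t, p x :=
    intervalIntegral.intervalIntegral_pos_of_pos_on (ii hpI)
      (fun x hx => hpos x (hsub (Set.Ioo_subset_Icc_self hx))) hst
  set P := ∫ x in s..t, p x with hPdef
  set μ := (∫ x in s..t, f x * p x) / P with hμ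
  set f0 : ℝ → ℝ := fun x => f x - μ with hf0
  have hf0c : Continuous f0 := hfc.sub continuous_const
  have hf0d : ∀ x, HasDerivAt f0 (f' x) x := fun x => (hf x).sub_const μ
  -- `f` is centred with respect to the weight, so the primitive `q` vanishes at both ends and the
  -- Wirtinger inequality applies to it.
  set q' : ℝ → ℝ := fun x => f0 x * p x with hq'
  set q : ℝ → ℝ := fun x => ∫ y in s..x, q' y with hq
  have hq'c : ContinuousOn q' (Set.Ioo a b) := hf0c.continuousOn.mul hpc
  have hqd : ∀ x ∈ Set.Icc s t, HasDerivAt q (q' x) x := by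
    intro x hx
    refine intervalIntegral.integral_hasDerivAt_right ?_
      (hq'c.stronglyMeasurableAtFilter isOpen_Ioo x (hsub hx))
      (hq'c.continuousAt (isOpen_Ioo.mem_nhds (hsub hx)))
    refine ContinuousOn.intervalIntegrable (hq'c.mono ?_)
    rw [Set.uIcc_of_le hx.1]
    exact (Set.Icc_subset_Icc_right hx.2).trans hsub
  have hqc : ContinuousOn q (Set.Icc s t) := fun x hx => (hqd x hx).continuousAt.continuousWithinAt
  have hfp : IntervalIntegrable (fun x => f x * p x) volume s t := ii (hfc.continuousOn.mul hpI)
  have hqs : q s = 0 := by simp [hq]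
  have hqt : q t = 0 := by
    have : q t = (∫ x in s..t, f x * p x) - μ * P := by
      rw [hPdef, ← intervalIntegral.integral_const_mul,
        ← intervalIntegral.integral_sub hfp ((ii hpI).const_mul _)]
      exact intervalIntegral.integral_congr fun x _ => by simp only [hq', hf0]; ring
    rw [this, hμ, div_mul_cancel₀ _ hP.ne', sub_self]
  set k := Real.pi / (b - a) with hk
  have hkpos : 0 < k := div_pos Real.pi_pos hba
  have hW := wirtinger_of_concave_weight has hst.le htb hp hpos
    (fun x hx => hqd x (Set.Ioo_subset_Icc_self hx)) hqc (hq'c.mono hsub) hqs hqt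
  rw [← hk] at hW
  have hp0 : ∀ x ∈ Set.Icc s t, p x ≠ 0 := fun x hx => (hpos x (hsub hx)).ne'
  have hA : ∫ x in s..t, q' x ^ 2 / p x = ∫ x in s..t, f0 x ^ 2 * p x :=
    intervalIntegral.integral_congr fun x hx => by
      rw [hu] at hx
      have := hp0 x hx
      simp only [hq']; field_simp
  rw [hA] at hW
  have hparts : ∫ x in s..t, f0 x ^ 2 * p x = ∫ x in s..t, -(f' x * q x) := by
    have h1 := intervalIntegral.integral_mul_deriv_eq_deriv_mul (a := s) (b := t) (u := f0) (v := q)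
      (u' := f') (v' := q') (fun x _ => hf0d x) (fun x hx => hqd x (by rwa [hu] at hx))
      (ii hf'.continuousOn) (ii (hq'c.mono hsub))
    rw [hqs, hqt] at h1
    rw [intervalIntegral.integral_neg, ← sub_zero (-_), ← mul_zero (f0 t), ← zero_sub,
      ← mul_zero (f0 s)]
    have h2 : ∫ x in s..t, f0 x ^ 2 * p x = ∫ x in s..t, f0 x * q' x :=
      intervalIntegral.integral_congr fun x _ => by simp only [hq']; ring
    rw [h2, h1]; ring
  have hXi : IntervalIntegrable (fun x => f' x ^ 2 * p x) volume s t :=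
    ii ((hf'.pow 2).continuousOn.mul hpI)
  have hQi : IntervalIntegrable (fun x => q x ^ 2 / p x) volume s t :=
    ii ((hqc.pow 2).div hpI hp0)
  -- Young's inequality with the factor `k²`: by `hW`, the second half is at most half of `∫ f0² p`
  -- and is absorbed on the left.
  have hle : ∫ x in s..t, -(f' x * q x) ≤
      ∫ x in s..t, ((1 / 2) * (1 / k ^ 2 * (f' x ^ 2 * p x)) + (1 / 2) * (k ^ 2 * (q x ^ 2 / p x))) := by
    refine intervalIntegral.integral_mono_on hst.le (ii (hf'.continuousOn.mul hqc).neg)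
      (((hXi.const_mul _).const_mul _).add ((hQi.const_mul _).const_mul _)) fun x hx => ?_
    have hpx := hpos x (hsub hx)
    have h1 : 0 ≤ (f' x * p x / k + k * q x) ^ 2 / p x / 2 := by positivity
    rw [← sub_nonneg]
    convert h1 using 1
    field_simp
    ring
  rw [← hparts, intervalIntegral.integral_add ((hXi.const_mul _).const_mul _) ((hQi.const_mul _).const_mul _)] at hle
  simp only [intervalIntegral.integral_const_mul] at hle
  have hk2 : 1 / k ^ 2 = ((b - a) / Real.pi) ^ 2 := by rw [hk]; field_simp
  rw [hk2] at hle
  have hexp : ∫ x in s..t, f x ^ 2 * p x = (∫ x in s..t, f0 x ^ 2 * p x) +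
      (∫ x in s..t, f x * p x) ^ 2 / P := by
    have e : ∫ x in s..t, f0 x ^ 2 * p x =
        ∫ x in s..t, (f x ^ 2 * p x - (2 * μ) * (f x * p x) + μ ^ 2 * p x) :=
      intervalIntegral.integral_congr fun x _ => by simp only [hf0]; ring
    have i1 : IntervalIntegrable (fun x => f x ^ 2 * p x) volume s t :=
      ii ((hfc.pow 2).continuousOn.mul hpI)
    rw [e, intervalIntegral.integral_add (i1.sub (hfp.const_mul _)) ((ii hpI).const_mul _),
      intervalIntegral.integral_sub i1 (hfp.const_mul _), intervalIntegral.integral_const_mul,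
      intervalIntegral.integral_const_mul, ← hPdef, hμ]
    field_simp
    ring
  rw [hexp]
  linarith

/-- The sharp Poincaré inequality on an interval, with a concave weight. -/
theorem weighted_poincare_Ioo {a b : ℝ} (hab : a < b)
    {p f f' : ℝ → ℝ} (hp : ConcaveOn ℝ (Set.Ioo a b) p) (hpos : ∀ x ∈ Set.Ioo a b, 0 < p x)
    (hpi : IntegrableOn p (Set.Ioo a b))
    (hf : ∀ x, HasDerivAt f (f' x) x) (hf' : Continuous f') :
    ∫ x in Set.Ioo a b, f x ^ 2 * p x ≤
      ((b - a) / Real.pi) ^ 2 * (∫ x in Set.Ioo a b, f' x ^ 2 * p x) +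
      (∫ x in Set.Ioo a b, f x * p x) ^ 2 / ∫ x in Set.Ioo a b, p x := by
  have hfc : Continuous f := continuous_iff_continuousAt.2 fun x => (hf x).continuousAt
  have hi : ∀ {g : ℝ → ℝ}, Continuous g → IntegrableOn (fun x => g x * p x) (Set.Ioo a b) := by
    intro g hg
    obtain ⟨C, hC⟩ := (isCompact_Icc (a := a) (b := b)).exists_bound_of_continuousOn hg.continuousOn
    exact Integrable.bdd_mul (c := C) hpi hg.aestronglyMeasurable
      ((ae_restrict_mem measurableSet_Ioo).mono fun x hx => hC x (Set.Ioo_subset_Icc_self hx))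
  -- The shift by `3` keeps `2 d n < b - a` from `n = 0` on, so every inner interval is
  -- nondegenerate.
  set d : ℕ → ℝ := fun n => (b - a) / (n + 3) with hd
  have hdpos : ∀ n, 0 < d n := fun n => div_pos (sub_pos.2 hab) (by positivity)
  have hdlt : ∀ n, 2 * d n < b - a := fun n => by
    rw [hd]; simp only
    rw [← mul_div_assoc, div_lt_iff₀ (by positivity)]
    have : (0 : ℝ) ≤ n := n.cast_nonneg
    nlinarith
  have hd0 : Tendsto d atTop (𝓝 0) := by
    have h : Tendsto (fun n : ℕ => (n : ℝ) + 3) atTop atTop :=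
      tendsto_atTop_add_const_right _ _ tendsto_natCast_atTop_atTop
    exact h.const_div_atTop (b - a)
  have hcov : AECover (volume.restrict (Set.Ioo a b)) atTop fun n => Set.Icc (a + d n) (b - d n) :=
    aecover_Ioo_of_Icc (by simpa using hd0.const_add a) (by simpa using hd0.const_sub b)
  have hlim : ∀ {g : ℝ → ℝ}, IntegrableOn g (Set.Ioo a b) →
      Tendsto (fun n => ∫ x in (a + d n)..(b - d n), g x) atTop (𝓝 (∫ x in Set.Ioo a b, g x)) := by
    intro g hg
    refine (hcov.integral_tendsto_of_countably_generated hg).congr fun n => ?_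
    rw [Measure.restrict_restrict measurableSet_Icc, intervalIntegral.integral_of_le (by linarith [hdlt n]),
      ← integral_Icc_eq_integral_Ioc, Set.inter_eq_left.2]
    exact fun x hx => ⟨by linarith [hx.1, hdpos n], by linarith [hx.2, hdpos n]⟩
  have hP : (∫ x in Set.Ioo a b, p x) ≠ 0 := by
    rw [← integral_Ioc_eq_integral_Ioo, ← intervalIntegral.integral_of_le hab.le]
    refine (intervalIntegral.intervalIntegral_pos_of_pos_on ?_ hpos hab).ne'
    rwa [intervalIntegrable_iff_integrableOn_Ioo_of_le hab.le]
  refine le_of_tendsto_of_tendsto' (hlim (hi (hfc.pow 2)))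
    (((hlim (hi (hf'.pow 2))).const_mul _).add (((hlim (hi hfc)).pow 2).div (hlim hpi) hP)) fun n => ?_
  exact weighted_poincare_Icc (by linarith [hdpos n]) (by linarith [hdlt n]) (by linarith [hdpos n])
    hp hpos hf hf'

/-! ### Plane convex sets: sections, ridge functions, thin sets -/

theorem exists_eq_Ioo_of_isOpen_convex {S : Set ℝ} (ho : IsOpen S) (hc : Convex ℝ S)
    (hb : Bornology.IsBounded S) (hne : S.Nonempty) : ∃ a b, a < b ∧ S = Set.Ioo a b := by
  have hconn : IsConnected S := ⟨hne, hc.isPreconnected⟩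
  have hsub := hconn.Ioo_csInf_csSup_subset hb.bddBelow hb.bddAbove
  have hS : S = Set.Ioo (sInf S) (sSup S) := by
    refine Set.Subset.antisymm (fun x hx => ?_) hsub
    obtain ⟨l, u, hxlu, hlu⟩ := mem_nhds_iff_exists_Ioo_subset.1 (ho.mem_nhds hx)
    obtain ⟨y, hy1, hy2⟩ := exists_between hxlu.1
    obtain ⟨z, hz1, hz2⟩ := exists_between hxlu.2
    exact ⟨(csInf_le hb.bddBelow (hlu ⟨hy1, hy2.trans hxlu.2⟩)).trans_lt hy2,
      hz1.trans_le (le_csSup hb.bddAbove (hlu ⟨hxlu.1.trans hz1, hz2⟩))⟩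
  obtain ⟨x, hx⟩ := hne
  rw [hS] at hx
  exact ⟨_, _, hx.1.trans hx.2, hS⟩

section Sections

variable {U : Set (ℝ × ℝ)}

theorem isBounded_prodMk_preimage (hb : Bornology.IsBounded U) (s : ℝ) :
    Bornology.IsBounded (Prod.mk s ⁻¹' U) := by
  refine (LipschitzWith.prod_snd.isBounded_image hb).subset fun t ht => ⟨(s, t), ht, rfl⟩

theorem convex_prodMk_preimage (hc : Convex ℝ U) (s : ℝ) : Convex ℝ (Prod.mk s ⁻¹' U) := by
  intro t ht t' ht' α β hα hβ hαβ
  have := hc ht ht' hα hβ hαβ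
  simpa [← add_mul, hαβ] using this

/-- The length of the vertical sections of a plane open convex set is a concave function. -/
theorem concaveOn_volume_prodMk_preimage (ho : IsOpen U) (hc : Convex ℝ U)
    (hb : Bornology.IsBounded U) :
    ConcaveOn ℝ (Prod.fst '' U) fun s => volume.real (Prod.mk s ⁻¹' U) := by
  refine ⟨hc.is_linear_image ⟨fun _ _ => rfl, fun _ _ => rfl⟩, ?_⟩
  have sec : ∀ s ∈ Prod.fst '' U, ∃ a b, a < b ∧ Prod.mk s ⁻¹' U = Set.Ioo a b := by
    rintro _ ⟨x, hx, rfl⟩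
    exact exists_eq_Ioo_of_isOpen_convex (ho.preimage (by fun_prop)) (convex_prodMk_preimage hc _)
      (isBounded_prodMk_preimage hb _) ⟨x.2, hx⟩
  intro s hs s' hs' l m hl hm hlm
  obtain ⟨a, b, hab, hS⟩ := sec s hs
  obtain ⟨a', b', hab', hS'⟩ := sec s' hs'
  -- By convexity the section over the combined point contains the combination of the two intervals,
  -- whose length is the combination of their lengths.
  have hsub : Set.Ioo (l * a + m * a') (l * b + m * b') ⊆ Prod.mk (l • s + m • s') ⁻¹' U := by
    intro t ht
    have hw : 0 < l * (b - a) + m * (b' - a') := by linarith [ht.1.trans ht.2]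
    -- The relative position of `t`; the points at this same ratio in the two sections combine to
    -- `t`.
    set r := (t - (l * a + m * a')) / (l * (b - a) + m * (b' - a')) with hr
    have hr0 : 0 < r := div_pos (by linarith [ht.1]) hw
    have hr1 : r < 1 := by rw [hr, div_lt_one hw]; linarith [ht.2]
    have h1 : (s, a + r * (b - a)) ∈ U := by
      have : a + r * (b - a) ∈ Prod.mk s ⁻¹' U := by rw [hS]; constructor <;> nlinarith
      exact this
    have h2 : (s', a' + r * (b' - a')) ∈ U := by
      have : a' + r * (b' - a') ∈ Prod.mk s' ⁻¹' U := by rw [hS']; constructor <;> nlinarith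
      exact this
    have h3 := hc h1 h2 hl hm hlm
    have h4 : r * (l * (b - a) + m * (b' - a')) = t - (l * a + m * a') := div_mul_cancel₀ _ hw.ne'
    have h5 : l * (a + r * (b - a)) + m * (a' + r * (b' - a')) = t := by linarith
    show (l • s + m • s', t) ∈ U
    convert h3 using 1
    simp [h5]
  have hfin : volume (Prod.mk (l • s + m • s') ⁻¹' U) ≠ ⊤ :=
    (isBounded_prodMk_preimage hb _).measure_lt_top.ne
  have := measureReal_mono hsub hfin
  simp only [hS, hS']
  refine le_trans (le_of_eq ?_) this
  rw [Real.volume_real_Ioo_of_le hab.le, Real.volume_real_Ioo_of_le hab'.le,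
    Real.volume_real_Ioo_of_le (by nlinarith)]
  simp only [smul_eq_mul]; ring

/-- Fubini: this is how the length of the sections becomes the one-dimensional weight. -/
theorem setIntegral_comp_fst (ho : IsOpen U) (hb : Bornology.IsBounded U) {g : ℝ → ℝ}
    (hg : Continuous g) :
    ∫ x in U, g x.1 = ∫ s, g s * volume.real (Prod.mk s ⁻¹' U) := by
  have hint : IntegrableOn (fun x : ℝ × ℝ => g x.1) U :=
    ((hg.comp continuous_fst).continuousOn.integrableOn_compact
      hb.isCompact_closure).mono_set subset_closure
  rw [← integral_indicator ho.measurableSet, Measure.volume_eq_prod, integral_prod]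
  · refine integral_congr_ae (Eventually.of_forall fun s => ?_)
    have : (fun t => U.indicator (fun x : ℝ × ℝ => g x.1) (s, t)) =
        (Prod.mk s ⁻¹' U).indicator fun _ => g s := by
      ext t; rfl
    simp only
    rw [this, integral_indicator_const _ (ho.preimage (by fun_prop)).measurableSet, smul_eq_mul, mul_comm]
  · exact (integrable_indicator_iff ho.measurableSet).2 hint

/-- The sharp Poincaré inequality on a plane convex set for functions of one coordinate. -/
theorem poincare_comp_fst (ho : IsOpen U) (hc : Convex ℝ U) (hb : Bornology.IsBounded U)
    (hne : U.Nonempty) {d : ℝ} (hd : ∀ x ∈ U, ∀ y ∈ U, |x.1 - y.1| ≤ d) {f f' : ℝ → ℝ}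
    (hf : ∀ x, HasDerivAt f (f' x) x) (hf' : Continuous f') :
    ∫ x in U, f x.1 ^ 2 ≤ (d / Real.pi) ^ 2 * (∫ x in U, f' x.1 ^ 2) +
      (∫ x in U, f x.1) ^ 2 / volume.real U := by
  have hfc : Continuous f := continuous_iff_continuousAt.2 fun x => (hf x).continuousAt
  obtain ⟨a, b, hab, hI⟩ := exists_eq_Ioo_of_isOpen_convex (isOpenMap_fst U ho)
    (hc.is_linear_image ⟨fun _ _ => rfl, fun _ _ => rfl⟩) (LipschitzWith.prod_fst.isBounded_image hb) (hne.image _)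
  set p : ℝ → ℝ := fun s => volume.real (Prod.mk s ⁻¹' U) with hp
  have hpc : ConcaveOn ℝ (Set.Ioo a b) p := hI ▸ concaveOn_volume_prodMk_preimage ho hc hb
  have hp0 : ∀ s ∉ Set.Ioo a b, p s = 0 := by
    intro s hs
    rw [← hI] at hs
    have : Prod.mk s ⁻¹' U = ∅ := Set.eq_empty_of_forall_notMem fun t ht => hs ⟨(s, t), ht, rfl⟩
    simp [hp, this]
  have hpos : ∀ s ∈ Set.Ioo a b, 0 < p s := by
    intro s hs
    rw [← hI] at hs
    obtain ⟨x, hx, rfl⟩ := hs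
    have h1 : 0 < volume (Prod.mk x.1 ⁻¹' U) :=
      (ho.preimage (by fun_prop)).measure_pos _ ⟨x.2, hx⟩
    exact ENNReal.toReal_pos h1.ne' (isBounded_prodMk_preimage hb _).measure_lt_top.ne
  have hpi : Integrable p := by
    refine Measure.integrable_measure_prodMk_left ho.measurableSet ?_
    exact hb.measure_lt_top.ne
  have key : ∀ {g : ℝ → ℝ}, Continuous g → ∫ x in U, g x.1 = ∫ s in Set.Ioo a b, g s * p s := by
    intro g hg
    rw [setIntegral_comp_fst ho hb hg, setIntegral_eq_integral_of_forall_compl_eq_zero]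
    intro s hs; rw [hp0 s hs, mul_zero]
  have hvol : volume.real U = ∫ s in Set.Ioo a b, p s := by
    have := key (g := fun _ => 1) continuous_const
    simpa using this
  have h := weighted_poincare_Ioo hab hpc hpos hpi.integrableOn hf hf'
  rw [key hfc, key (g := fun s => f s ^ 2) (hfc.pow 2), key (g := fun s => f' s ^ 2) (hf'.pow 2), hvol]
  refine h.trans (add_le_add (mul_le_mul_of_nonneg_right ?_ ?_) le_rfl)
  · have hle : b - a ≤ d := by
      refine le_of_forall_pos_lt_add fun e he => ?_
      -- The endpoints are not attained, so points at distance `e' / 2` from them are used instead;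
      -- the second bound on `e'` keeps them in the interval.
      set e' := min (e / 2) ((b - a) / 2) with he'
      have hee : 0 < e' := lt_min (by linarith) (by linarith)
      have h1 : e' ≤ e / 2 := min_le_left _ _
      have h2 : e' ≤ (b - a) / 2 := min_le_right _ _
      have ha : a + e' / 2 ∈ Set.Ioo a b := ⟨by linarith, by linarith⟩
      have hb' : b - e' / 2 ∈ Set.Ioo a b := ⟨by linarith, by linarith⟩
      rw [← hI] at ha hb'
      obtain ⟨x, hx, hx'⟩ := ha
      obtain ⟨y, hy, hy'⟩ := hb'
      have := (le_abs_self _).trans (hd y hy x hx)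
      rw [hx', hy'] at this
      linarith
    have : 0 < b - a := sub_pos.2 hab
    gcongr
  · exact setIntegral_nonneg measurableSet_Ioo fun s hs =>
      mul_nonneg (sq_nonneg _) (hpos s hs).le

end Sections

/-- The plane in the coordinates of an orthonormal basis. -/
noncomputable def OrthonormalBasis.planeEquiv (e : OrthonormalBasis (Fin 2) ℝ (EuclideanSpace ℝ (Fin 2))) :
    ℝ × ℝ ≃ᵐ EuclideanSpace ℝ (Fin 2) :=
  (MeasurableEquiv.finTwoArrow.symm.trans (MeasurableEquiv.toLp 2 (Fin 2 → ℝ))).trans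
    e.repr.symm.toHomeomorph.toMeasurableEquiv

theorem OrthonormalBasis.planeEquiv_apply
    (e : OrthonormalBasis (Fin 2) ℝ (EuclideanSpace ℝ (Fin 2))) (x : ℝ × ℝ) :
    e.planeEquiv x = x.1 • e 0 + x.2 • e 1 := by
  have : e.planeEquiv x = e.repr.symm (WithLp.toLp 2 ![x.1, x.2]) := rfl
  rw [this, ← e.sum_repr_symm, Fin.sum_univ_two]
  simp

theorem OrthonormalBasis.measurePreserving_planeEquiv
    (e : OrthonormalBasis (Fin 2) ℝ (EuclideanSpace ℝ (Fin 2))) :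
    MeasurePreserving e.planeEquiv :=
  e.measurePreserving_repr_symm.comp
    ((PiLp.volume_preserving_toLp (Fin 2)).comp (volume_preserving_finTwoArrow ℝ).symm)

theorem OrthonormalBasis.inner_planeEquiv
    (e : OrthonormalBasis (Fin 2) ℝ (EuclideanSpace ℝ (Fin 2))) (x : ℝ × ℝ) :
    inner ℝ (e 0) (e.planeEquiv x) = x.1 := by
  rw [e.planeEquiv_apply, inner_add_right, inner_smul_right, inner_smul_right,
    e.inner_eq_ite, e.inner_eq_ite]
  simp

/-- The sharp Poincaré inequality on a plane convex set for ridge functions. -/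
theorem poincare_ridge (e : OrthonormalBasis (Fin 2) ℝ (EuclideanSpace ℝ (Fin 2)))
    {K : Set (EuclideanSpace ℝ (Fin 2))} (ho : IsOpen K) (hc : Convex ℝ K)
    (hb : Bornology.IsBounded K) (hne : K.Nonempty) {d : ℝ} (hd : ∀ x ∈ K, ∀ y ∈ K, dist x y ≤ d)
    {f f' : ℝ → ℝ} (hf : ∀ x, HasDerivAt f (f' x) x) (hf' : Continuous f') :
    ∫ x in K, f (inner ℝ (e 0) x) ^ 2 ≤
      (d / Real.pi) ^ 2 * (∫ x in K, f' (inner ℝ (e 0) x) ^ 2) +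
      (∫ x in K, f (inner ℝ (e 0) x)) ^ 2 / volume.real K := by
  have hmp := e.measurePreserving_planeEquiv
  have hme := e.planeEquiv.measurableEmbedding
  set T := e.planeEquiv with hT
  have hTlin : ∀ x, T x = (ContinuousLinearMap.fst ℝ ℝ ℝ).smulRight (e 0) x +
    (ContinuousLinearMap.snd ℝ ℝ ℝ).smulRight (e 1) x := fun x => by
      rw [hT, e.planeEquiv_apply]; rfl
  have hTc : Continuous T := by
    rw [show (T : ℝ × ℝ → _) = fun x => _ from funext hTlin]; fun_prop
  have key : ∀ g : ℝ → ℝ, ∫ x in K, g (inner ℝ (e 0) x) = ∫ x in T ⁻¹' K, g x.1 := by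
    intro g
    rw [← hmp.setIntegral_preimage_emb hme]
    simp only [hT, e.inner_planeEquiv]
  have hvol : volume.real K = volume.real (T ⁻¹' K) := by
    rw [measureReal_def, measureReal_def, hmp.measure_preimage ho.measurableSet.nullMeasurableSet]
  rw [key f, key (fun s => f s ^ 2), key (fun s => f' s ^ 2), hvol]
  have hdist : ∀ x ∈ T ⁻¹' K, ∀ y ∈ T ⁻¹' K, |x.1 - y.1| ≤ d := by
    intro x hx y hy
    refine le_trans ?_ (hd _ hx _ hy)
    rw [← e.inner_planeEquiv x, ← e.inner_planeEquiv y, ← inner_sub_right, dist_eq_norm]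
    refine (abs_real_inner_le_norm _ _).trans ?_
    rw [e.orthonormal.1 0, one_mul]
  refine poincare_comp_fst (ho.preimage hTc) ?_ ?_ ?_ hdist hf hf'
  · have := hc.linear_preimage ((ContinuousLinearMap.fst ℝ ℝ ℝ).smulRight (e 0) +
      (ContinuousLinearMap.snd ℝ ℝ ℝ).smulRight (e 1)).toLinearMap
    have hT' : T ⁻¹' K = ((ContinuousLinearMap.fst ℝ ℝ ℝ).smulRight (e 0) +
        (ContinuousLinearMap.snd ℝ ℝ ℝ).smulRight (e 1)).toLinearMap ⁻¹' K := by
      ext x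
      rw [Set.mem_preimage, hTlin]; rfl
    rwa [hT']
  · obtain ⟨R, hR⟩ := hb.exists_norm_le
    refine (isBounded_iff_forall_norm_le).2 ⟨R, fun x hx => ?_⟩
    have h0 := hR _ hx
    rw [Prod.norm_def, max_le_iff]
    have i0 : inner ℝ (e 0) (T x) = x.1 := e.inner_planeEquiv x
    have i1 : inner ℝ (e 1) (T x) = x.2 := by
      rw [hT, e.planeEquiv_apply, inner_add_right, inner_smul_right, inner_smul_right,
        e.inner_eq_ite, e.inner_eq_ite]
      simp
    constructor
    · rw [← i0]
      exact (norm_inner_le_norm _ _).trans (by rwa [e.orthonormal.1 0, one_mul])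
    · rw [← i1]
      exact (norm_inner_le_norm _ _).trans (by rwa [e.orthonormal.1 1, one_mul])
  · obtain ⟨x, hx⟩ := hne
    exact ⟨T.symm x, by simpa using hx⟩

theorem Continuous.integrableOn_of_isBounded {n : ℕ} {F : Type*} [NormedAddCommGroup F]
    {f : EuclideanSpace ℝ (Fin n) → F} (hf : Continuous f) {K : Set (EuclideanSpace ℝ (Fin n))}
    (hb : Bornology.IsBounded K) : IntegrableOn f K :=
  (hf.continuousOn.integrableOn_compact hb.isCompact_closure).mono_set subset_closure

/-- An almost sharp Poincaré inequality on thin plane convex sets. -/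
theorem poincare_thin (e : OrthonormalBasis (Fin 2) ℝ (EuclideanSpace ℝ (Fin 2)))
    {K : Set (EuclideanSpace ℝ (Fin 2))} (ho : IsOpen K) (hc : Convex ℝ K)
    (hb : Bornology.IsBounded K) (hne : K.Nonempty) {d : ℝ} (hd : ∀ x ∈ K, ∀ y ∈ K, dist x y ≤ d)
    {f : EuclideanSpace ℝ (Fin 2) → ℝ} {f' : EuclideanSpace ℝ (Fin 2) → EuclideanSpace ℝ (Fin 2) →L[ℝ] ℝ}
    (hf : ∀ x, HasFDerivAt f (f' x) x) (hf' : Continuous f') {c ε η M : ℝ}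
    (hη : 0 ≤ η) (hthin : ∀ x ∈ K, |inner ℝ (e 1) x - c| ≤ ε)
    (hM : ∀ x ∈ K, |f x| ≤ M ∧ ‖f' x‖ ≤ M)
    (hosc : ∀ x ∈ K, ∀ y, dist x y ≤ ε → |f x - f y| ≤ η ∧ ‖f' x - f' y‖ ≤ η)
    (h0 : ∫ x in K, f x = 0) :
    ∫ x in K, f x ^ 2 ≤ (d / Real.pi) ^ 2 * (∫ x in K, ‖f' x‖ ^ 2) +
      (η * (2 * M + η) * (1 + (d / Real.pi) ^ 2) + η ^ 2) * volume.real K := by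
  have hfc : Continuous f := continuous_iff_continuousAt.2 fun x => (hf x).continuousAt
  -- Every point of `K` is within `ε` of its projection to this line, so `f` is within `η` of the
  -- ridge function that reads its values off the line.
  set ℓ : ℝ → EuclideanSpace ℝ (Fin 2) := fun s => s • e 0 + c • e 1 with hℓ
  have hℓc : Continuous ℓ := by fun_prop
  have hℓd : ∀ s, HasDerivAt ℓ (e 0) s := fun s => by
    have h := ((hasDerivAt_id s).smul_const (e 0)).add_const (c • e 1)
    rw [one_smul] at h
    exact h
  set g : ℝ → ℝ := fun s => f (ℓ s) with hg
  set g' : ℝ → ℝ := fun s => f' (ℓ s) (e 0) with hg'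
  have hgd : ∀ s, HasDerivAt g (g' s) s := fun s => (hf (ℓ s)).comp_hasDerivAt s (hℓd s)
  have hg'c : Continuous g' := (hf'.comp hℓc).clm_apply continuous_const
  have hgc : Continuous g := hfc.comp hℓc
  have hπc : Continuous fun x : EuclideanSpace ℝ (Fin 2) => inner ℝ (e 0) x := by fun_prop
  have hdist : ∀ x ∈ K, dist x (ℓ (inner ℝ (e 0) x)) ≤ ε := by
    intro x hx
    have h1 := e.sum_repr' x
    rw [Fin.sum_univ_two] at h1
    have h2 : x - ℓ (inner ℝ (e 0) x) = (inner ℝ (e 1) x - c) • e 1 := by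
      nth_rewrite 1 [← h1]
      simp only [hℓ, sub_smul]; abel
    rw [dist_eq_norm, h2, norm_smul, e.orthonormal.1 1, mul_one, Real.norm_eq_abs]
    exact hthin x hx
  have hV : 0 < volume.real K :=
    ENNReal.toReal_pos (ho.measure_pos _ hne).ne' hb.measure_lt_top.ne
  have hms := ho.measurableSet
  have hR := poincare_ridge e ho hc hb hne hd hgd hg'c
  have ii : ∀ {u : EuclideanSpace ℝ (Fin 2) → ℝ}, Continuous u → IntegrableOn u K :=
    fun hu => hu.integrableOn_of_isBounded hb
  have ic : ∀ r : ℝ, ∫ _ in K, r = r * volume.real K := fun r => by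
    rw [setIntegral_const, smul_eq_mul, mul_comm]
  have hGc : Continuous fun x => g (inner ℝ (e 0) x) := hgc.comp hπc
  have hG'c : Continuous fun x => g' (inner ℝ (e 0) x) := hg'c.comp hπc
  have hN : Continuous fun x => ‖f' x‖ ^ 2 := hf'.norm.pow 2
  have hf2 : Continuous fun x => f x ^ 2 := hfc.pow 2
  have hG2 : Continuous fun x => g (inner ℝ (e 0) x) ^ 2 := hGc.pow 2
  have hG'2 : Continuous fun x => g' (inner ℝ (e 0) x) ^ 2 := hG'c.pow 2
  have e1 : ∫ x in K, f x ^ 2 ≤ (∫ x in K, g (inner ℝ (e 0) x) ^ 2) + η * (2 * M + η) * volume.real K := by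
    rw [← ic, ← integral_add (ii hG2) (ii continuous_const)]
    refine setIntegral_mono_on (ii hf2) (ii (hG2.add continuous_const)) hms fun x hx => ?_
    have h1 := abs_le.1 (hosc x hx _ (hdist x hx)).1
    have h2 := abs_le.1 (hM x hx).1
    simp only [hg]
    nlinarith [h1.1, h1.2, h2.1, h2.2]
  have e2 : ∫ x in K, g' (inner ℝ (e 0) x) ^ 2 ≤ (∫ x in K, ‖f' x‖ ^ 2) + η * (2 * M + η) * volume.real K := by
    rw [← ic, ← integral_add (ii hN) (ii continuous_const)]
    refine setIntegral_mono_on (ii hG'2) (ii (hN.add continuous_const)) hms fun x hx => ?_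
    have h1 := (hosc x hx _ (hdist x hx)).2
    have h2 := (hM x hx).2
    have h3 : |g' (inner ℝ (e 0) x)| ≤ ‖f' x‖ + η := by
      have h4 := (f' (ℓ (inner ℝ (e 0) x))).le_opNorm (e 0)
      rw [e.orthonormal.1 0, mul_one] at h4
      rw [← Real.norm_eq_abs]
      refine h4.trans ?_
      have h5 := norm_sub_norm_le (f' (ℓ (inner ℝ (e 0) x))) (f' x)
      rw [norm_sub_rev] at h5
      linarith
    have h6 := norm_nonneg (f' x)
    rw [← sq_abs]
    nlinarith [abs_nonneg (g' (inner ℝ (e 0) x))]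
  -- The ridge function need not have zero mean, but `f` has, so its mean is at most `η` in absolute
  -- value.
  have e3 : (∫ x in K, g (inner ℝ (e 0) x)) ^ 2 / volume.real K ≤ η ^ 2 * volume.real K := by
    have h1 : |∫ x in K, g (inner ℝ (e 0) x)| ≤ η * volume.real K := by
      have h2 : ∫ x in K, g (inner ℝ (e 0) x) = ∫ x in K, (g (inner ℝ (e 0) x) - f x) := by
        rw [integral_sub (ii hGc) (ii hfc), h0, sub_zero]
      rw [h2, ← Real.norm_eq_abs]
      refine norm_setIntegral_le_of_norm_le_const hb.measure_lt_top fun x hx => ?_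
      rw [Real.norm_eq_abs, abs_sub_comm]
      exact (hosc x hx _ (hdist x hx)).1
    rw [div_le_iff₀ hV, ← sq_abs]
    calc |∫ x in K, g (inner ℝ (e 0) x)| ^ 2 ≤ (η * volume.real K) ^ 2 := by gcongr
      _ = _ := by ring
  have hd2 : 0 ≤ (d / Real.pi) ^ 2 := sq_nonneg _
  nlinarith [mul_le_mul_of_nonneg_left e2 hd2]

/-! ### Bisection and the Payne–Weinberger inequality -/

theorem volume_setOf_inner_sub_eq_zero {m : ℕ} {n : EuclideanSpace ℝ (Fin m)} (hn : n ≠ 0)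
    (x₀ : EuclideanSpace ℝ (Fin m)) : volume {x | inner ℝ n (x - x₀) = 0} = 0 := by
  have h1 : volume ((LinearMap.ker (innerSL ℝ n).toLinearMap : Submodule ℝ _) :
      Set (EuclideanSpace ℝ (Fin m))) = 0 := by
    refine Measure.addHaar_submodule _ _ fun h => hn ?_
    have h2 : n ∈ LinearMap.ker (innerSL ℝ n).toLinearMap := h ▸ Submodule.mem_top
    have h3 : inner ℝ n n = 0 := h2
    exact inner_self_eq_zero.1 h3
  rw [← measure_preimage_add_right volume (-x₀)] at h1
  simp only [sub_eq_add_neg]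
  exact h1

/-- The cutting hyperplane is null, so both halves can be taken open without losing any integral. -/
theorem setIntegral_inter_lt_add_inter_gt {m : ℕ} {n : EuclideanSpace ℝ (Fin m)} (hn : n ≠ 0)
    (x₀ : EuclideanSpace ℝ (Fin m)) {K : Set (EuclideanSpace ℝ (Fin m))} (hK : MeasurableSet K)
    {f : EuclideanSpace ℝ (Fin m) → ℝ} (hf : IntegrableOn f K) :
    (∫ x in K ∩ {x | inner ℝ n (x - x₀) < 0}, f x) +
      ∫ x in K ∩ {x | 0 < inner ℝ n (x - x₀)}, f x = ∫ x in K, f x := by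
  have hms' : MeasurableSet {x | 0 < inner ℝ n (x - x₀)} :=
    (isOpen_lt continuous_const (by fun_prop)).measurableSet
  rw [← setIntegral_union _ (hK.inter hms') (hf.mono_set Set.inter_subset_left)
    (hf.mono_set Set.inter_subset_left)]
  · refine setIntegral_congr_set ?_
    have : ∀ᵐ x ∂(volume : Measure (EuclideanSpace ℝ (Fin m))), inner ℝ n (x - x₀) ≠ 0 := by
      rw [ae_iff]; simpa using volume_setOf_inner_sub_eq_zero hn x₀
    filter_upwards [this] with x hx
    refine propext ⟨fun h => h.elim (·.1) (·.1), fun h => ?_⟩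
    exact (lt_or_gt_of_ne hx).elim (fun h' => Or.inl ⟨h, h'⟩) fun h' => Or.inr ⟨h, h'⟩
  · refine Set.disjoint_left.2 fun x hx hx' => ?_
    have h1 : inner ℝ n (x - x₀) < 0 := hx.2
    have h2 : 0 < inner ℝ n (x - x₀) := hx'.2
    exact lt_asymm h1 h2

/-- A zero-mean function on a plane set has zero mean on both sides of some line through a given
point. -/
theorem exists_bisecting_line {K : Set (EuclideanSpace ℝ (Fin 2))} (hK : MeasurableSet K)
    {f : EuclideanSpace ℝ (Fin 2) → ℝ} (hf : IntegrableOn f K) (h0 : ∫ x in K, f x = 0)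
    (x₀ : EuclideanSpace ℝ (Fin 2)) :
    ∃ n : EuclideanSpace ℝ (Fin 2), n ≠ 0 ∧
      ∫ x in K ∩ {x | inner ℝ n (x - x₀) < 0}, f x = 0 ∧
      ∫ x in K ∩ {x | 0 < inner ℝ n (x - x₀)}, f x = 0 := by
  set n : ℝ → EuclideanSpace ℝ (Fin 2) := fun θ => !₂[Real.cos θ, Real.sin θ] with hn
  have hinner : ∀ θ x, inner ℝ (n θ) x = Real.cos θ * x 0 + Real.sin θ * x 1 := by
    intro θ x
    simp [hn, PiLp.inner_apply, Fin.sum_univ_two, mul_comm]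
  have hn0 : ∀ θ, n θ ≠ 0 := by
    intro θ h
    have h1 : inner ℝ (n θ) (n θ) = 1 := by
      rw [hinner]; simp only [hn]
      simp [← sq]
    rw [h, inner_zero_left] at h1
    exact zero_ne_one h1
  have hnull := fun θ => volume_setOf_inner_sub_eq_zero (hn0 θ) x₀
  have hms : ∀ θ, MeasurableSet {x | inner ℝ (n θ) (x - x₀) < 0} := fun θ =>
    (isOpen_lt (by fun_prop) continuous_const).measurableSet
  set I : ℝ → ℝ := fun θ => ∫ x in K, {x | inner ℝ (n θ) (x - x₀) < 0}.indicator f x with hI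
  have hIeq : ∀ θ, I θ = ∫ x in K ∩ {x | inner ℝ (n θ) (x - x₀) < 0}, f x := fun θ => by
    rw [hI]; exact setIntegral_indicator (hms θ)
  -- Dominated convergence: off the null line belonging to `θ₀`, the indicator is locally constant
  -- in `θ`.
  have hIc : Continuous I := by
    refine continuous_iff_continuousAt.2 fun θ₀ => ?_
    refine continuousAt_of_dominated (bound := fun x => ‖f x‖) (Eventually.of_forall fun θ => ?_)
      (Eventually.of_forall fun θ => Eventually.of_forall fun x => norm_indicator_le_norm_self _ _)
      hf.norm ?_
    · exact hf.aestronglyMeasurable.indicator (hms θ)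
    · have : ∀ᵐ x ∂(volume : Measure (EuclideanSpace ℝ (Fin 2))), inner ℝ (n θ₀) (x - x₀) ≠ 0 := by
        rw [ae_iff]; simpa using hnull θ₀
      refine (ae_restrict_of_ae this).mono fun x hx => ?_
      have hcont : Continuous fun θ => inner ℝ (n θ) (x - x₀) := by
        simp only [hinner]; fun_prop
      rcases lt_or_gt_of_ne hx with h | h
      · refine ContinuousAt.congr (f := fun _ => f x) continuousAt_const ?_
        filter_upwards [hcont.continuousAt.eventually (gt_mem_nhds h)] with θ hθ
        exact (Set.indicator_of_mem (s := {x | inner ℝ (n θ) (x - x₀) < 0}) hθ f).symm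
      · refine ContinuousAt.congr (f := fun _ => (0 : ℝ)) continuousAt_const ?_
        filter_upwards [hcont.continuousAt.eventually (lt_mem_nhds h)] with θ hθ
        exact (Set.indicator_of_notMem (s := {x | inner ℝ (n θ) (x - x₀) < 0}) (not_lt.2 hθ.le) f).symm
  have hsum : ∀ θ, I θ + ∫ x in K ∩ {x | 0 < inner ℝ (n θ) (x - x₀)}, f x = 0 := fun θ => by
    rw [hIeq, setIntegral_inter_lt_add_inter_gt (hn0 θ) x₀ hK hf, h0]
  -- A half turn exchanges the two half-planes, whose integrals are opposite; the intermediate value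
  -- theorem then gives a zero of `I`.
  have hpi : I Real.pi = - I 0 := by
    have h1 := hsum 0
    have h2 : {x | inner ℝ (n Real.pi) (x - x₀) < 0} = {x | 0 < inner ℝ (n 0) (x - x₀)} := by
      ext x; simp [hinner]
    rw [hIeq Real.pi, h2]; linarith
  obtain ⟨θ, hθ⟩ : (0 : ℝ) ∈ Set.range I := by
    rcases le_total (I 0) 0 with h | h
    · exact mem_range_of_exists_le_of_exists_ge hIc ⟨0, h⟩ ⟨Real.pi, by linarith⟩
    · exact mem_range_of_exists_le_of_exists_ge hIc ⟨Real.pi, by linarith⟩ ⟨0, h⟩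
  refine ⟨n θ, hn0 θ, by rw [← hIeq, hθ], ?_⟩
  have := hsum θ
  rwa [hθ, zero_add] at this

/-- A family of plane open convex sets in which every point can be cut off contains arbitrarily
thin sets. -/
theorem exists_thin_of_cutting {P : Set (EuclideanSpace ℝ (Fin 2)) → Prop}
    (hP : ∀ K, P K → IsOpen K ∧ Convex ℝ K ∧ K.Nonempty)
    (hcut : ∀ K, P K → ∀ x, ∃ K' ⊆ K, P K' ∧ x ∉ K')
    {Ω : Set (EuclideanSpace ℝ (Fin 2))} (hΩ : P Ω) (hb : Bornology.IsBounded Ω) :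
    ∃ (e : OrthonormalBasis (Fin 2) ℝ (EuclideanSpace ℝ (Fin 2))) (c : ℝ), ∀ ε > 0,
      ∃ K ⊆ Ω, P K ∧ ∀ x ∈ K, |inner ℝ (e 1) x - c| ≤ ε := by
  choose! S hSsub hSP hSx using hcut
  -- At stage `j` the `j`-th point of a dense sequence is cut off.
  set K : ℕ → Set (EuclideanSpace ℝ (Fin 2)) := fun j =>
    Nat.rec Ω (fun i A => S A (TopologicalSpace.denseSeq _ i)) j with hK
  have hKs : ∀ j, K (j + 1) = S (K j) (TopologicalSpace.denseSeq _ j) := fun j => rfl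
  have hKP : ∀ j, P (K j) := by
    intro j
    induction j with
    | zero => exact hΩ
    | succ j ih => rw [hKs]; exact hSP _ ih _
  have hanti : Antitone K := antitone_nat_of_succ_le fun j => by
    rw [hKs]; exact hSsub _ (hKP j) _
  have hx : ∀ j, TopologicalSpace.denseSeq _ j ∉ K (j + 1) := fun j => by
    rw [hKs]; exact hSx _ (hKP j) _
  have hsubΩ : ∀ j, K j ⊆ Ω := fun j => hanti (Nat.zero_le j)
  have hcomp : ∀ j, IsCompact (closure (K j)) := fun j => (hb.subset (hsubΩ j)).isCompact_closure
  have hdir : Directed (· ⊇ ·) fun j => closure (K j) :=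
    directed_of_isDirected_le fun i j hij => closure_mono (hanti hij)
  set C := ⋂ j, closure (K j) with hC
  have hCne : C.Nonempty := IsCompact.nonempty_iInter_of_directed_nonempty_isCompact_isClosed _ hdir
    (fun j => (hP _ (hKP j)).2.2.closure) hcomp fun j => isClosed_closure
  have hCconv : Convex ℝ C := convex_iInter fun j => (hP _ (hKP j)).2.1.closure
  -- An interior point could be taken in the dense sequence. It would lie in the interior of the
  -- closure of the set from which it was cut off, and for an open convex set that interior is the
  -- set itself.
  have hCint : ¬ (interior C).Nonempty := by
    intro h
    obtain ⟨j, hj⟩ := (TopologicalSpace.denseRange_denseSeq _).exists_mem_open isOpen_interior h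
    obtain ⟨ho, hc, hne⟩ := hP _ (hKP (j + 1))
    have h1 : TopologicalSpace.denseSeq _ j ∈ interior (closure (K (j + 1))) :=
      interior_mono (Set.iInter_subset _ (j + 1)) hj
    rw [hc.interior_closure_eq_interior_of_nonempty_interior (by rwa [ho.interior_eq]), ho.interior_eq] at h1
    exact hx j h1
  rw [hCconv.interior_nonempty_iff_affineSpan_eq_top] at hCint
  obtain ⟨x₀, hx₀⟩ := hCne
  have hdirne : (affineSpan ℝ C).direction ≠ ⊤ := fun h =>
    hCint ((AffineSubspace.direction_eq_top_iff_of_nonempty ⟨x₀, subset_affineSpan ℝ C hx₀⟩).1 h)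
  -- Without interior, the convex set `C` spans a proper affine subspace, so it lies in a line with
  -- normal `n`.
  obtain ⟨n, hn, hn0⟩ : ∃ n ∈ ((affineSpan ℝ C).direction)ᗮ, n ≠ 0 :=
    Submodule.exists_mem_ne_zero_of_ne_bot fun h => hdirne (Submodule.orthogonal_eq_bot_iff.1 h)
  obtain ⟨e, he⟩ : ∃ e : OrthonormalBasis (Fin 2) ℝ (EuclideanSpace ℝ (Fin 2)),
      e 1 = (‖n‖⁻¹ : ℝ) • n := by
    have hv : Orthonormal ℝ (({1} : Set (Fin 2)).domRestrict fun _ : Fin 2 => (‖n‖⁻¹ : ℝ) • n) := by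
      refine ⟨fun i => ?_, fun i j hij => (hij (Subsingleton.elim i j)).elim⟩
      simp [Set.domRestrict, norm_smul, hn0]
    obtain ⟨e, he⟩ := hv.exists_orthonormalBasis_extension_of_card_eq (by simp)
    exact ⟨e, he 1 rfl⟩
  refine ⟨e, inner ℝ (e 1) x₀, fun ε hε => ?_⟩
  have hCe : ∀ x ∈ C, inner ℝ (e 1) x = inner ℝ (e 1) x₀ := by
    intro x hx
    rw [← sub_eq_zero, ← inner_sub_right, he, inner_smul_left]
    have h1 : x - x₀ ∈ (affineSpan ℝ C).direction :=
      AffineSubspace.vsub_mem_direction (subset_affineSpan ℝ C hx) (subset_affineSpan ℝ C hx₀)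
    rw [Submodule.inner_left_of_mem_orthogonal h1 hn, mul_zero]
  -- By compactness some stage already lies in the `ε`-strip around that line.
  obtain ⟨j, hj⟩ := exists_subset_nhds_of_isCompact hdir hcomp
    (U := {x | |inner ℝ (e 1) x - inner ℝ (e 1) x₀| < ε}) fun x hx => by
      refine (isOpen_lt (by fun_prop) continuous_const).mem_nhds ?_
      simp [hCe x hx, hε]
  exact ⟨K j, hsubΩ j, hKP j, fun x hx => (hj (subset_closure hx)).le⟩

/-- **Payne–Weinberger inequality** for a continuously differentiable function on a plane convex
set. -/
theorem payne_weinberger {Ω : Set (EuclideanSpace ℝ (Fin 2))} (ho : IsOpen Ω) (hc : Convex ℝ Ω)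
    (hb : Bornology.IsBounded Ω) {f : EuclideanSpace ℝ (Fin 2) → ℝ}
    {f' : EuclideanSpace ℝ (Fin 2) → EuclideanSpace ℝ (Fin 2) →L[ℝ] ℝ}
    (hf : ∀ x, HasFDerivAt f (f' x) x) (hf' : Continuous f') (h0 : ∫ x in Ω, f x = 0) :
    ∫ x in Ω, f x ^ 2 ≤ (Metric.diam Ω / Real.pi) ^ 2 * ∫ x in Ω, ‖f' x‖ ^ 2 := by
  have hfc : Continuous f := continuous_iff_continuousAt.2 fun x => (hf x).continuousAt
  have hN : Continuous fun x => ‖f' x‖ ^ 2 := hf'.norm.pow 2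
  have hf2 : Continuous fun x => f x ^ 2 := hfc.pow 2
  set A := (Metric.diam Ω / Real.pi) ^ 2 with hA
  have hA0 : 0 ≤ A := sq_nonneg _
  by_contra hlt
  rw [not_le] at hlt
  have hne : Ω.Nonempty := by
    rw [Set.nonempty_iff_ne_empty]; rintro rfl; simp at hlt
  have hV : 0 < volume.real Ω :=
    ENNReal.toReal_pos (ho.measure_pos _ hne).ne' hb.measure_lt_top.ne
  -- Half of the violation per unit area: `u` keeps a positive integral over `Ω`, and each piece
  -- with `∫ u > 0` violates the inequality by more than `δ` times its area.
  set δ := ((∫ x in Ω, f x ^ 2) - A * ∫ x in Ω, ‖f' x‖ ^ 2) / (2 * volume.real Ω) with hδ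
  have hδ0 : 0 < δ := div_pos (sub_pos.2 hlt) (by positivity)
  set u : EuclideanSpace ℝ (Fin 2) → ℝ := fun x => f x ^ 2 - A * ‖f' x‖ ^ 2 - δ with hu
  have huc : Continuous u := (hf2.sub (hN.const_mul _)).sub continuous_const
  have hint : ∀ {K : Set (EuclideanSpace ℝ (Fin 2))}, Bornology.IsBounded K → ∫ x in K, u x =
      (∫ x in K, f x ^ 2) - A * (∫ x in K, ‖f' x‖ ^ 2) - δ * volume.real K := by
    intro K hK
    have i1 := hf2.integrableOn_of_isBounded hK
    have i2 := (hN.const_mul A).integrableOn_of_isBounded hK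
    have i12 : IntegrableOn (fun x => f x ^ 2 - A * ‖f' x‖ ^ 2) K := i1.sub i2
    have i3 := (continuous_const (y := δ)).integrableOn_of_isBounded hK
    simp only [hu]
    rw [integral_sub i12 i3, integral_sub i1 i2, integral_const_mul, setIntegral_const,
      smul_eq_mul, mul_comm δ]
  set P : Set (EuclideanSpace ℝ (Fin 2)) → Prop := fun K =>
    K ⊆ Ω ∧ IsOpen K ∧ Convex ℝ K ∧ ∫ x in K, f x = 0 ∧ 0 < ∫ x in K, u x with hPdef
  have hPΩ : P Ω := by
    refine ⟨subset_rfl, ho, hc, h0, ?_⟩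
    rw [hint hb]
    have : δ * volume.real Ω = ((∫ x in Ω, f x ^ 2) - A * ∫ x in Ω, ‖f' x‖ ^ 2) / 2 := by
      rw [hδ]; field_simp
    linarith
  have hPK : ∀ K, P K → IsOpen K ∧ Convex ℝ K ∧ K.Nonempty := by
    rintro K ⟨-, h1, h2, -, h3⟩
    refine ⟨h1, h2, Set.nonempty_iff_ne_empty.2 ?_⟩
    rintro rfl; simp at h3
  have hcut : ∀ K, P K → ∀ x, ∃ K' ⊆ K, P K' ∧ x ∉ K' := by
    rintro K ⟨hKΩ, hKo, hKc, hK0, hKu⟩ x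
    have hKb := hb.subset hKΩ
    obtain ⟨n, hn0, h1, h2⟩ := exists_bisecting_line hKo.measurableSet
      (hfc.integrableOn_of_isBounded hKb) hK0 x
    have ho1 : IsOpen {y | inner ℝ n (y - x) < 0} := isOpen_lt (by fun_prop) continuous_const
    have ho2 : IsOpen {y | 0 < inner ℝ n (y - x)} := isOpen_lt continuous_const (by fun_prop)
    have hlin : IsLinearMap ℝ fun y => inner ℝ n y :=
      ⟨fun y z => inner_add_right _ _ _, fun r y => inner_smul_right _ _ _⟩
    have hc1 : Convex ℝ {y | inner ℝ n (y - x) < 0} := by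
      simp only [inner_sub_right, sub_neg]
      exact convex_halfSpace_lt hlin _
    have hc2 : Convex ℝ {y | 0 < inner ℝ n (y - x)} := by
      simp only [inner_sub_right, sub_pos]
      exact convex_halfSpace_gt hlin _
    have hiu := huc.integrableOn_of_isBounded hKb
    have hsum := setIntegral_inter_lt_add_inter_gt hn0 x hKo.measurableSet hiu
    -- The integrals of `u` over the halves have a positive sum, so one of them is positive; the
    -- point `x` is on the line and belongs to neither half.
    by_cases h : 0 < ∫ y in K ∩ {y | inner ℝ n (y - x) < 0}, u y
    · exact ⟨_, Set.inter_subset_left, ⟨Set.inter_subset_left.trans hKΩ, hKo.inter ho1,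
        hKc.inter hc1, h1, h⟩, fun hx => by simpa using hx.2⟩
    · exact ⟨_, Set.inter_subset_left, ⟨Set.inter_subset_left.trans hKΩ, hKo.inter ho2,
        hKc.inter hc2, h2, by linarith⟩, fun hx => by simpa using hx.2⟩
  obtain ⟨e, c, hthin⟩ := exists_thin_of_cutting hPK hcut hPΩ hb
  obtain ⟨R, hR⟩ := hb.subset_closedBall 0
  -- The projections to the line may leave `Ω`. The strip width is kept at most `1`, so they stay in
  -- this larger ball, where `f` and `f'` are uniformly continuous.
  have hcpt := isCompact_closedBall (0 : EuclideanSpace ℝ (Fin 2)) (R + 1)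
  obtain ⟨M₁, hM₁⟩ := hcpt.exists_bound_of_continuousOn hfc.continuousOn
  obtain ⟨M₂, hM₂⟩ := hcpt.exists_bound_of_continuousOn hf'.continuousOn
  set M := max M₁ M₂ with hM
  obtain ⟨η, hη0, hηδ⟩ : ∃ η > 0, η * (2 * M + η) * (1 + A) + η ^ 2 < δ := by
    have h1 : Tendsto (fun η : ℝ => η * (2 * M + η) * (1 + A) + η ^ 2) (𝓝[>] 0) (𝓝 0) := by
      have h2 : Continuous (fun η : ℝ => η * (2 * M + η) * (1 + A) + η ^ 2) := by fun_prop
      have h3 := (h2.tendsto 0).mono_left (nhdsWithin_le_nhds (s := Set.Ioi 0))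
      simpa using h3
    obtain ⟨η, h4, h5⟩ := ((h1.eventually (gt_mem_nhds hδ0)).and self_mem_nhdsWithin).exists
    exact ⟨η, h5, h4⟩
  have huf := hcpt.uniformContinuousOn_of_continuous hfc.continuousOn
  have huf' := hcpt.uniformContinuousOn_of_continuous hf'.continuousOn
  rw [Metric.uniformContinuousOn_iff_le] at huf huf'
  obtain ⟨ε₁, hε₁, h₁⟩ := huf η hη0
  obtain ⟨ε₂, hε₂, h₂⟩ := huf' η hη0
  obtain ⟨K, hKΩ, ⟨-, hKo, hKc, hK0, hKu⟩, hKt⟩ := hthin (min 1 (min ε₁ ε₂)) (by positivity)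
  have hKb := hb.subset hKΩ
  have hKne := (hPK K ⟨hKΩ, hKo, hKc, hK0, hKu⟩).2.2
  have hin : ∀ x ∈ K, ‖x‖ ≤ R := fun x hx => by simpa using hR (hKΩ hx)
  have hball : ∀ x ∈ K, x ∈ Metric.closedBall (0 : EuclideanSpace ℝ (Fin 2)) (R + 1) := fun x hx => by
    rw [mem_closedBall_zero_iff]; linarith [hin x hx]
  have hT := poincare_thin e hKo hKc hKb hKne
    (fun x hx y hy => Metric.dist_le_diam_of_mem hb (hKΩ hx) (hKΩ hy)) hf hf' hη0.le hKt
    (M := M) (fun x hx => ⟨(hM₁ x (hball x hx)).trans (le_max_left _ _),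
      (hM₂ x (hball x hx)).trans (le_max_right _ _)⟩)
    (fun x hx y hxy => by
      have hy : y ∈ Metric.closedBall (0 : EuclideanSpace ℝ (Fin 2)) (R + 1) := by
        rw [mem_closedBall_zero_iff]
        have h3 := hxy.trans (min_le_left _ _)
        have h4 := norm_le_norm_add_norm_sub' y x
        rw [dist_eq_norm, norm_sub_rev] at h3
        linarith [hin x hx]
      have h5 := hxy.trans (min_le_right _ _)
      refine ⟨?_, ?_⟩
      · exact h₁ x (hball x hx) y hy (h5.trans (min_le_left _ _))
      · rw [← dist_eq_norm]; exact h₂ x (hball x hx) y hy (h5.trans (min_le_right _ _)))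
    hK0
  rw [hint hKb] at hKu
  have := measureReal_nonneg (μ := volume) (s := K)
  nlinarith

/-! ### Coordinates and Fubini's theorem on a prism -/

/-- Space as the product of the base plane and the vertical axis. -/
noncomputable def spaceEquiv : EuclideanSpace ℝ (Fin 2) × ℝ ≃ᵐ EuclideanSpace ℝ (Fin 3) :=
  ((((MeasurableEquiv.toLp 2 (Fin 2 → ℝ)).symm.prodCongr (MeasurableEquiv.refl ℝ)).trans
    MeasurableEquiv.prodComm).trans
      (MeasurableEquiv.piFinSuccAbove (fun _ => ℝ) (Fin.last 2)).symm).trans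
        (MeasurableEquiv.toLp 2 (Fin 3 → ℝ))

theorem spaceEquiv_apply (y : EuclideanSpace ℝ (Fin 2)) (z : ℝ) :
    spaceEquiv (y, z) = !₂[y 0, y 1, z] := by
  ext i
  fin_cases i <;> rfl

theorem measurePreserving_spaceEquiv : MeasurePreserving spaceEquiv := by
  refine (PiLp.volume_preserving_toLp (Fin 3)).comp
    ((volume_preserving_piFinSuccAbove (fun _ => ℝ) (Fin.last 2)).symm.comp ?_)
  exact (Measure.measurePreserving_swap).comp
    ((PiLp.volume_preserving_ofLp (Fin 2)).prod (MeasurePreserving.id _))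

theorem horizontal_spaceEquiv (y : EuclideanSpace ℝ (Fin 2)) (z : ℝ) :
    horizontal (spaceEquiv (y, z)) = y := by
  rw [spaceEquiv_apply]
  ext i
  fin_cases i <;> rfl

theorem spaceEquiv_apply_two (y : EuclideanSpace ℝ (Fin 2)) (z : ℝ) :
    spaceEquiv (y, z) 2 = z := by
  rw [spaceEquiv_apply]; rfl

/-- The embedding of the base plane as a linear isometry. -/
noncomputable def baseIsometry : EuclideanSpace ℝ (Fin 2) →ₗᵢ[ℝ] EuclideanSpace ℝ (Fin 3) where
  toFun := onBase
  map_add' x y := by ext i; fin_cases i <;> simp [onBase]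
  map_smul' r x := by ext i; fin_cases i <;> simp [onBase]
  norm_map' x := by
    simp [EuclideanSpace.norm_eq, Fin.sum_univ_succ, onBase]

theorem baseIsometry_apply (y : EuclideanSpace ℝ (Fin 2)) : baseIsometry y = onBase y := rfl

theorem spaceEquiv_eq_add (y : EuclideanSpace ℝ (Fin 2)) (z : ℝ) :
    spaceEquiv (y, z) = baseIsometry y + z • EuclideanSpace.single 2 1 := by
  rw [spaceEquiv_apply, baseIsometry_apply]
  ext i
  fin_cases i <;> simp [onBase]

theorem continuous_spaceEquiv : Continuous spaceEquiv := by
  have : (spaceEquiv : EuclideanSpace ℝ (Fin 2) × ℝ → _) =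
      fun p => baseIsometry p.1 + p.2 • EuclideanSpace.single 2 1 :=
    funext fun p => spaceEquiv_eq_add p.1 p.2
  rw [this]
  have := baseIsometry.continuous
  fun_prop

section Prism

variable {Γ : Set (EuclideanSpace ℝ (Fin 2))} {H : EuclideanSpace ℝ (Fin 2) → ℝ}

theorem spaceEquiv_mem_prism {y : EuclideanSpace ℝ (Fin 2)} {z : ℝ} :
    spaceEquiv (y, z) ∈ prism Γ H ↔ y ∈ Γ ∧ z ∈ Set.Ioo 0 (H y) := by
  simp [prism, horizontal_spaceEquiv, spaceEquiv_apply_two]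

theorem indicator_prism_spaceEquiv {u : EuclideanSpace ℝ (Fin 3) → ℝ}
    (y : EuclideanSpace ℝ (Fin 2)) :
    ∫ z, (prism Γ H).indicator u (spaceEquiv (y, z)) =
      Γ.indicator (fun y => ∫ z in Set.Ioo 0 (H y), u (spaceEquiv (y, z))) y := by
  by_cases hy : y ∈ Γ
  · rw [Set.indicator_of_mem hy, ← integral_indicator measurableSet_Ioo]
    refine integral_congr_ae (Eventually.of_forall fun z => ?_)
    beta_reduce
    by_cases hz : z ∈ Set.Ioo 0 (H y)
    · rw [Set.indicator_of_mem hz, Set.indicator_of_mem (spaceEquiv_mem_prism.2 ⟨hy, hz⟩)]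
    · rw [Set.indicator_of_notMem hz,
        Set.indicator_of_notMem fun h => hz (spaceEquiv_mem_prism.1 h).2]
  · rw [Set.indicator_of_notMem hy]
    simp [spaceEquiv_mem_prism, hy]

variable {u : EuclideanSpace ℝ (Fin 3) → ℝ}

theorem integrable_indicator_prism_comp (hm : MeasurableSet (prism Γ H))
    (hu : IntegrableOn u (prism Γ H)) :
    Integrable fun p => (prism Γ H).indicator u (spaceEquiv p) :=
  (measurePreserving_spaceEquiv.integrable_comp_emb spaceEquiv.measurableEmbedding).2
    ((integrable_indicator_iff hm).2 hu)

theorem setIntegral_prism (hm : MeasurableSet (prism Γ H)) (hΓ : MeasurableSet Γ)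
    (hu : IntegrableOn u (prism Γ H)) :
    ∫ x in prism Γ H, u x = ∫ y in Γ, ∫ z in Set.Ioo 0 (H y), u (spaceEquiv (y, z)) := by
  rw [← integral_indicator hm, ← measurePreserving_spaceEquiv.integral_comp
    spaceEquiv.measurableEmbedding, Measure.volume_eq_prod,
    integral_prod _ (integrable_indicator_prism_comp hm hu)]
  simp only [indicator_prism_spaceEquiv]
  rw [integral_indicator hΓ]

theorem integrableOn_integral_prism (hm : MeasurableSet (prism Γ H)) (hΓ : MeasurableSet Γ)
    (hu : IntegrableOn u (prism Γ H)) :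
    IntegrableOn (fun y => ∫ z in Set.Ioo 0 (H y), u (spaceEquiv (y, z))) Γ := by
  have h : Integrable fun y => ∫ z, (prism Γ H).indicator u (spaceEquiv (y, z)) :=
    Integrable.integral_prod_left (integrable_indicator_prism_comp hm hu)
  simp only [indicator_prism_spaceEquiv] at h
  exact (integrable_indicator_iff hΓ).1 h

end Prism

/-! ### The Poincaré inequality on a convex cylinder -/

/-- The integral of the squared deviation from the mean is non-negative. -/
theorem sq_intervalIntegral_le {h : ℝ} (hh : 0 < h) {g : ℝ → ℝ} (hg : Continuous g) :
    (∫ z in (0 : ℝ)..h, g z) ^ 2 ≤ h * ∫ z in (0 : ℝ)..h, g z ^ 2 := by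
  set m := (∫ z in (0 : ℝ)..h, g z) / h with hm
  have h1 : 0 ≤ ∫ z in (0 : ℝ)..h, (g z - m) ^ 2 :=
    intervalIntegral.integral_nonneg hh.le fun z _ => sq_nonneg _
  have h2 : ∫ z in (0 : ℝ)..h, (g z - m) ^ 2 = (∫ z in (0 : ℝ)..h, g z ^ 2) -
      2 * m * (∫ z in (0 : ℝ)..h, g z) + h * m ^ 2 := by
    have e : ∀ z, (g z - m) ^ 2 = g z ^ 2 - 2 * m * g z + m ^ 2 := fun z => by ring
    simp only [e]
    have i1 : IntervalIntegrable (fun z => g z ^ 2) volume 0 h := (hg.pow 2).intervalIntegrable _ _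
    have i2 : IntervalIntegrable (fun z => 2 * m * g z) volume 0 h :=
      (hg.const_mul _).intervalIntegrable _ _
    rw [intervalIntegral.integral_add (i1.sub i2) intervalIntegrable_const,
      intervalIntegral.integral_sub i1 i2, intervalIntegral.integral_const_mul]
    simp
  have h3 : h * m = ∫ z in (0 : ℝ)..h, g z := by rw [hm]; field_simp
  rw [h2, ← h3] at h1
  rw [← h3]
  nlinarith

section Cylinder

variable {Γ : Set (EuclideanSpace ℝ (Fin 2))} {h : ℝ}

theorem isOpen_prism_const (hΓ : IsOpen Γ) : IsOpen (prism Γ fun _ => h) := by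
  have hc : Continuous horizontal := by unfold horizontal; fun_prop
  have hc2 : Continuous fun x : EuclideanSpace ℝ (Fin 3) => x 2 := by fun_prop
  exact (hΓ.preimage hc).inter ((isOpen_lt continuous_const hc2).inter (isOpen_lt hc2 continuous_const))

theorem isBounded_prism_const (hb : Bornology.IsBounded Γ) :
    Bornology.IsBounded (prism Γ fun _ => h) := by
  have : prism Γ (fun _ => h) ⊆ spaceEquiv '' (closure Γ ×ˢ Set.Icc 0 h) := by
    intro x hx
    obtain ⟨⟨y, z⟩, rfl⟩ := spaceEquiv.surjective x
    rw [spaceEquiv_mem_prism] at hx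
    exact ⟨(y, z), ⟨subset_closure hx.1, hx.2.1.le, hx.2.2.le⟩, rfl⟩
  exact ((hb.isCompact_closure.prod isCompact_Icc).image continuous_spaceEquiv).isBounded.subset this

/-- A Poincaré inequality for continuously differentiable functions on a convex cylinder. -/
theorem poincare_cylinder (ho : IsOpen Γ) (hc : Convex ℝ Γ)
    (hb : Bornology.IsBounded Γ) (hh : 0 < h) {φ : EuclideanSpace ℝ (Fin 3) → ℝ}
    (hφ : ContDiff ℝ 1 φ) (h0 : ∫ x in prism Γ (fun _ => h), φ x = 0) :
    ∫ x in prism Γ (fun _ => h), φ x ^ 2 ≤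
      ((Metric.diam Γ ^ 2 + h ^ 2) / Real.pi ^ 2) *
        ∫ x in prism Γ (fun _ => h), ‖fderiv ℝ φ x‖ ^ 2 := by
  have hΩo := isOpen_prism_const (h := h) ho
  have hΩb := isBounded_prism_const (h := h) hb
  have hφc := hφ.continuous
  have hφ'c : Continuous (fderiv ℝ φ) := hφ.continuous_fderiv one_ne_zero
  have hφd : ∀ x, HasFDerivAt φ (fderiv ℝ φ x) x := fun x =>
    (hφ.differentiable one_ne_zero x).hasFDerivAt
  set T := spaceEquiv with hT
  have hTc : Continuous T := continuous_spaceEquiv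
  set ι := baseIsometry.toContinuousLinearMap with hι
  set e3 : EuclideanSpace ℝ (Fin 3) := EuclideanSpace.single 2 1 with he3
  have hι1 : ‖ι‖ ≤ 1 := baseIsometry.norm_toContinuousLinearMap_le
  have he31 : ‖e3‖ = 1 := by simp [he3]
  -- The fibre integral carries what the vertical inequality cannot control; its mean over `Γ` is
  -- zero because that of `φ` over the cylinder is.
  set F : EuclideanSpace ℝ (Fin 2) → ℝ := fun y => ∫ z in (0 : ℝ)..h, φ (T (y, z)) with hF
  set D : EuclideanSpace ℝ (Fin 2) → ℝ → EuclideanSpace ℝ (Fin 2) →L[ℝ] ℝ :=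
    fun y z => (fderiv ℝ φ (T (y, z))).comp ι with hD
  have hDc : Continuous (Function.uncurry D) := by
    have : Continuous fun p : EuclideanSpace ℝ (Fin 2) × ℝ => (fderiv ℝ φ (T p)).comp ι :=
      (hφ'c.comp hTc).clm_comp continuous_const
    exact this
  have hDle : ∀ y z, ‖D y z‖ ≤ ‖fderiv ℝ φ (T (y, z))‖ := fun y z =>
    (ContinuousLinearMap.opNorm_comp_le _ _).trans (mul_le_of_le_one_right (norm_nonneg _) hι1)
  set F' : EuclideanSpace ℝ (Fin 2) → EuclideanSpace ℝ (Fin 2) →L[ℝ] ℝ :=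
    fun y => ∫ z in (0 : ℝ)..h, D y z with hF'
  have hFd : ∀ y, HasFDerivAt F (F' y) y := by
    intro y
    have hcpt : IsCompact (T '' (Metric.closedBall y 1 ×ˢ Set.Icc 0 h)) :=
      ((isCompact_closedBall y 1).prod isCompact_Icc).image hTc
    obtain ⟨C, hC⟩ := hcpt.exists_bound_of_continuousOn hφ'c.continuousOn
    refine intervalIntegral.hasFDerivAt_integral_of_dominated_of_fderiv_le
      (F := fun y z => φ (T (y, z))) (F' := D) (bound := fun _ => C)
      (Metric.closedBall_mem_nhds y one_pos) (Eventually.of_forall fun y => ?_) ?_ ?_ ?_ ?_ ?_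
    · exact (hφc.comp (hTc.comp (by fun_prop))).aestronglyMeasurable
    · exact (hφc.comp (hTc.comp (by fun_prop))).intervalIntegrable _ _
    · exact (hDc.comp (by fun_prop : Continuous fun z => (y, z))).aestronglyMeasurable
    · refine Eventually.of_forall fun z hz x hx => ?_
      rw [Set.uIoc_of_le hh.le] at hz
      exact (hDle x z).trans (hC _ ⟨(x, z), ⟨hx, hz.1.le, hz.2⟩, rfl⟩)
    · exact intervalIntegrable_const
    · refine Eventually.of_forall fun z _ x _ => ?_
      have h1 : HasFDerivAt (fun y => T (y, z)) ι x := by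
        have h2 := ι.hasFDerivAt.add_const (z • e3) (x := x)
        refine h2.congr_of_eventuallyEq (Eventually.of_forall fun y => ?_)
        exact spaceEquiv_eq_add y z
      exact (hφd (T (x, z))).comp x h1
  have hF'c : Continuous F' :=
    intervalIntegral.continuous_parametric_intervalIntegral_of_continuous' hDc 0 h
  have hFc : Continuous F := continuous_iff_continuousAt.2 fun y => (hFd y).continuousAt
  have hN : Continuous fun x => ‖fderiv ℝ φ x‖ ^ 2 := hφ'c.norm.pow 2
  have hφ2 : Continuous fun x => φ x ^ 2 := hφc.pow 2
  have fub : ∀ {u : EuclideanSpace ℝ (Fin 3) → ℝ}, Continuous u →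
      ∫ x in prism Γ (fun _ => h), u x = ∫ y in Γ, ∫ z in (0 : ℝ)..h, u (T (y, z)) := by
    intro u hu
    rw [setIntegral_prism hΩo.measurableSet ho.measurableSet (hu.integrableOn_of_isBounded hΩb)]
    simp only [intervalIntegral.integral_of_le hh.le, integral_Ioc_eq_integral_Ioo, hT]
  have fubi : ∀ {u : EuclideanSpace ℝ (Fin 3) → ℝ}, Continuous u →
      IntegrableOn (fun y => ∫ z in (0 : ℝ)..h, u (T (y, z))) Γ := by
    intro u hu
    have := integrableOn_integral_prism hΩo.measurableSet ho.measurableSet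
      (hu.integrableOn_of_isBounded hΩb)
    simpa only [intervalIntegral.integral_of_le hh.le, integral_Ioc_eq_integral_Ioo, hT] using this
  have hFΓ : ∫ y in Γ, F y = 0 := by rw [← h0, fub hφc]
  have hPW := payne_weinberger ho hc hb hFd hF'c hFΓ
  have hF2 : Continuous fun y => F y ^ 2 := hFc.pow 2
  -- the vertical direction
  have hvert : ∫ x in prism Γ (fun _ => h), φ x ^ 2 ≤
      (h / Real.pi) ^ 2 * (∫ x in prism Γ (fun _ => h), ‖fderiv ℝ φ x‖ ^ 2) +
        h⁻¹ * ∫ y in Γ, F y ^ 2 := by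
    rw [fub hφ2, fub hN, ← integral_const_mul, ← integral_const_mul,
      ← integral_add ((fubi hN).const_mul _) ((hF2.integrableOn_of_isBounded hb).const_mul _)]
    refine setIntegral_mono_on (fubi hφ2) (((fubi hN).const_mul _).add
      ((hF2.integrableOn_of_isBounded hb).const_mul _)) ho.measurableSet fun y _ => ?_
    set ψ : ℝ → ℝ := fun z => φ (T (y, z)) with hψ
    set ψ' : ℝ → ℝ := fun z => fderiv ℝ φ (T (y, z)) e3 with hψ'
    have hψd : ∀ z, HasDerivAt ψ (ψ' z) z := by
      intro z
      have h1 : HasDerivAt (fun z => T (y, z)) e3 z := by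
        have h2 := ((hasDerivAt_id z).smul_const e3).const_add (baseIsometry y)
        rw [one_smul] at h2
        refine h2.congr_of_eventuallyEq (Eventually.of_forall fun z => ?_)
        exact spaceEquiv_eq_add y z
      exact (hφd (T (y, z))).comp_hasDerivAt z h1
    have hTy : Continuous fun z => T (y, z) := hTc.comp (by fun_prop)
    have hψ'c : Continuous ψ' := (hφ'c.comp hTy).clm_apply continuous_const
    -- The constant weight gives the classical inequality on the fibre, with constant `h / π`.
    have h1 := weighted_poincare_Ioo (p := fun _ => 1) hh (concaveOn_const 1 (convex_Ioo 0 h))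
      (fun _ _ => one_pos) (by simp) hψd hψ'c
    simp only [mul_one, sub_zero, ← integral_Ioc_eq_integral_Ioo,
      ← intervalIntegral.integral_of_le hh.le] at h1
    have h2 : ∫ z in (0 : ℝ)..h, ψ' z ^ 2 ≤ ∫ z in (0 : ℝ)..h, ‖fderiv ℝ φ (T (y, z))‖ ^ 2 := by
      refine intervalIntegral.integral_mono_on hh.le ((hψ'c.pow 2).intervalIntegrable _ _)
        ((hN.comp hTy).intervalIntegrable _ _) fun z _ => ?_
      have h3 := (fderiv ℝ φ (T (y, z))).le_opNorm e3
      rw [he31, mul_one] at h3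
      rw [← sq_abs, ← Real.norm_eq_abs]
      gcongr
    have h4 : ∫ _ in (0 : ℝ)..h, (1 : ℝ) = h := by simp
    rw [h4] at h1
    have h5 : 0 ≤ (h / Real.pi) ^ 2 := sq_nonneg _
    have h6 : (∫ z in (0 : ℝ)..h, ψ z) ^ 2 / h = h⁻¹ * F y ^ 2 := by rw [div_eq_inv_mul]
    rw [h6] at h1
    exact h1.trans (add_le_add (mul_le_mul_of_nonneg_left h2 h5) le_rfl)
  -- `F'` integrates the horizontal derivative, whose norm is at most that of the full one;
  -- Cauchy–Schwarz on the fibre costs the factor `h`, which cancels the `h⁻¹` in `hvert`.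
  have hgrad : ∫ y in Γ, ‖F' y‖ ^ 2 ≤ h * ∫ x in prism Γ (fun _ => h), ‖fderiv ℝ φ x‖ ^ 2 := by
    rw [fub hN, ← integral_const_mul]
    refine setIntegral_mono_on ((hF'c.norm.pow 2).integrableOn_of_isBounded hb)
      ((fubi hN).const_mul _) ho.measurableSet fun y _ => ?_
    have hTy : Continuous fun z => T (y, z) := hTc.comp (by fun_prop)
    have hg : Continuous fun z => ‖fderiv ℝ φ (T (y, z))‖ := (hφ'c.comp hTy).norm
    have h1 : ‖F' y‖ ≤ ∫ z in (0 : ℝ)..h, ‖fderiv ℝ φ (T (y, z))‖ :=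
      intervalIntegral.norm_integral_le_of_norm_le hh.le
        (Eventually.of_forall fun z _ => hDle y z) (hg.intervalIntegrable _ _)
    calc ‖F' y‖ ^ 2 ≤ (∫ z in (0 : ℝ)..h, ‖fderiv ℝ φ (T (y, z))‖) ^ 2 := by gcongr
      _ ≤ _ := sq_intervalIntegral_le hh hg
  have hA : 0 ≤ (Metric.diam Γ / Real.pi) ^ 2 := sq_nonneg _
  have h1 := hPW.trans (mul_le_mul_of_nonneg_left hgrad hA)
  have h2 := mul_le_mul_of_nonneg_left h1 (inv_pos.2 hh).le
  have h3 : h⁻¹ * ((Metric.diam Γ / Real.pi) ^ 2 *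
      (h * ∫ x in prism Γ (fun _ => h), ‖fderiv ℝ φ x‖ ^ 2)) =
      (Metric.diam Γ / Real.pi) ^ 2 * ∫ x in prism Γ (fun _ => h), ‖fderiv ℝ φ x‖ ^ 2 := by
    field_simp
  rw [h3] at h2
  refine (hvert.trans (add_le_add le_rfl h2)).trans (le_of_eq ?_)
  rw [div_pow, div_pow]
  ring

end Cylinder

/-! ### Tools in `L²` -/

section L2

variable {α E : Type*} [MeasurableSpace α] {μ : Measure α} [NormedAddCommGroup E]

theorem MeasureTheory.MemLp.integrable_norm_sq {f : α → E} (hf : MemLp f 2 μ) :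
    Integrable (fun x => ‖f x‖ ^ 2) μ :=
  hf.norm.integrable_sq

/-- The bridge from extended norms to real integrals, so that estimates can be made in `ℝ`. -/
theorem MeasureTheory.MemLp.eLpNorm_two_sq {f : α → E} (hf : MemLp f 2 μ) :
    eLpNorm f 2 μ ^ 2 = ENNReal.ofReal (∫ x, ‖f x‖ ^ 2 ∂μ) := by
  rw [ofReal_integral_eq_lintegral_ofReal hf.integrable_norm_sq
    (Eventually.of_forall fun x => sq_nonneg _)]
  have h := eLpNorm_nnreal_pow_eq_lintegral (f := f) (μ := μ) (p := 2) two_ne_zero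
  have h2 : ((2 : ℝ≥0) : ℝ) = ((2 : ℕ) : ℝ) := by norm_num
  rw [h2, ENNReal.rpow_natCast] at h
  refine (Eq.trans ?_ h).trans ?_
  · norm_num
  · refine lintegral_congr fun x => ?_
    rw [ENNReal.rpow_natCast, ENNReal.ofReal_pow (norm_nonneg _), ofReal_norm]

/-- The Cauchy–Schwarz inequality. -/
theorem sq_integral_mul_le {f g : α → ℝ} (hf : MemLp f 2 μ) (hg : MemLp g 2 μ) :
    (∫ x, f x * g x ∂μ) ^ 2 ≤ (∫ x, f x ^ 2 ∂μ) * ∫ x, g x ^ 2 ∂μ := by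
  have hfg : Integrable (fun x => f x * g x) μ := hf.integrable_mul hg
  have h : ∀ t : ℝ, 0 ≤ (∫ x, f x ^ 2 ∂μ) * (t * t) + (2 * ∫ x, f x * g x ∂μ) * t +
      ∫ x, g x ^ 2 ∂μ := by
    intro t
    have h1 : 0 ≤ ∫ x, (t * f x + g x) ^ 2 ∂μ := integral_nonneg fun x => sq_nonneg _
    have e : ∀ x, (t * f x + g x) ^ 2 = (t * t) * f x ^ 2 + (2 * t) * (f x * g x) + g x ^ 2 :=
      fun x => by ring
    simp only [e] at h1
    have i1 : Integrable (fun x => (t * t) * f x ^ 2) μ := hf.integrable_sq.const_mul _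
    have i2 : Integrable (fun x => (2 * t) * (f x * g x)) μ := hfg.const_mul _
    have i12 : Integrable (fun x => (t * t) * f x ^ 2 + (2 * t) * (f x * g x)) μ := i1.add i2
    rw [integral_add i12 hg.integrable_sq, integral_add i1 i2, integral_const_mul,
      integral_const_mul] at h1
    linarith
  have := discrim_le_zero h
  rw [discrim] at this
  linarith

theorem tendsto_integral_norm_sub_sq {F : ℕ → α → E} {f : α → E} (hF : ∀ k, MemLp (F k) 2 μ)
    (hf : MemLp f 2 μ)
    (h : Tendsto (fun k => eLpNorm (fun x => F k x - f x) 2 μ) atTop (𝓝 0)) :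
    Tendsto (fun k => ∫ x, ‖F k x - f x‖ ^ 2 ∂μ) atTop (𝓝 0) := by
  have h1 : Tendsto (fun k => (eLpNorm (fun x => F k x - f x) 2 μ ^ 2).toReal) atTop (𝓝 0) := by
    have h2 := ENNReal.Tendsto.pow (n := 2) h
    rw [zero_pow two_ne_zero] at h2
    exact (ENNReal.tendsto_toReal ENNReal.zero_ne_top).comp h2
  refine h1.congr fun k => ?_
  have hk : MemLp (fun x => F k x - f x) 2 μ := (hF k).sub hf
  rw [hk.eLpNorm_two_sq, ENNReal.toReal_ofReal (integral_nonneg fun x => sq_nonneg _)]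

/-- Cauchy–Schwarz applied to `ψ` and `F k - f`. -/
theorem tendsto_integral_mul_of_tendsto_eLpNorm {F : ℕ → α → ℝ} {f ψ : α → ℝ}
    (hF : ∀ k, MemLp (F k) 2 μ) (hf : MemLp f 2 μ) (hψ : MemLp ψ 2 μ)
    (h : Tendsto (fun k => eLpNorm (fun x => F k x - f x) 2 μ) atTop (𝓝 0)) :
    Tendsto (fun k => ∫ x, ψ x * F k x ∂μ) atTop (𝓝 (∫ x, ψ x * f x ∂μ)) := by
  have h1 := ((tendsto_integral_norm_sub_sq hF hf h).const_mul (∫ x, ψ x ^ 2 ∂μ)).sqrt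
  rw [mul_zero, Real.sqrt_zero] at h1
  rw [tendsto_iff_norm_sub_tendsto_zero]
  refine squeeze_zero (fun k => norm_nonneg _) (fun k => ?_) h1
  have hk : MemLp (fun x => F k x - f x) 2 μ := (hF k).sub hf
  have i1 : Integrable (fun x => ψ x * F k x) μ := hψ.integrable_mul (hF k)
  have i2 : Integrable (fun x => ψ x * f x) μ := hψ.integrable_mul hf
  rw [← integral_sub i1 i2, Real.norm_eq_abs]
  refine Real.abs_le_sqrt ?_
  simp only [← mul_sub, Real.norm_eq_abs, sq_abs]
  exact sq_integral_mul_le hψ hk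

/-- The difference of squared norms is at most `‖F k - f‖² + 2 ‖F k - f‖ ‖f‖` pointwise, and
Cauchy–Schwarz handles the product. -/
theorem tendsto_integral_norm_sq_of_tendsto_eLpNorm {F : ℕ → α → E} {f : α → E}
    (hF : ∀ k, MemLp (F k) 2 μ) (hf : MemLp f 2 μ)
    (h : Tendsto (fun k => eLpNorm (fun x => F k x - f x) 2 μ) atTop (𝓝 0)) :
    Tendsto (fun k => ∫ x, ‖F k x‖ ^ 2 ∂μ) atTop (𝓝 (∫ x, ‖f x‖ ^ 2 ∂μ)) := by
  have h0 := tendsto_integral_norm_sub_sq hF hf h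
  have h1 := h0.add ((h0.mul_const (∫ x, ‖f x‖ ^ 2 ∂μ)).sqrt.const_mul 2)
  rw [zero_mul, Real.sqrt_zero, mul_zero, add_zero] at h1
  rw [tendsto_iff_norm_sub_tendsto_zero]
  refine squeeze_zero (fun k => norm_nonneg _) (fun k => ?_) h1
  have hk : MemLp (fun x => F k x - f x) 2 μ := (hF k).sub hf
  have i3 : Integrable (fun x => ‖F k x - f x‖ * ‖f x‖) μ := hk.norm.integrable_mul hf.norm
  rw [← integral_sub (hF k).integrable_norm_sq hf.integrable_norm_sq]
  calc ‖∫ x, (‖F k x‖ ^ 2 - ‖f x‖ ^ 2) ∂μ‖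
      ≤ ∫ x, (‖F k x - f x‖ ^ 2 + 2 * (‖F k x - f x‖ * ‖f x‖)) ∂μ := by
        refine norm_integral_le_of_norm_le (hk.integrable_norm_sq.add (i3.const_mul 2))
          (Eventually.of_forall fun x => ?_)
        have h2 := abs_le.1 (abs_norm_sub_norm_le (F k x) (f x))
        have h3 := norm_nonneg (F k x)
        have h4 := norm_nonneg (f x)
        rw [Real.norm_eq_abs, abs_le]
        constructor <;> nlinarith
    _ = (∫ x, ‖F k x - f x‖ ^ 2 ∂μ) + 2 * ∫ x, ‖F k x - f x‖ * ‖f x‖ ∂μ := by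
        rw [integral_add hk.integrable_norm_sq (i3.const_mul 2), integral_const_mul]
    _ ≤ _ := by
        gcongr
        exact (le_abs_self _).trans (Real.abs_le_sqrt (sq_integral_mul_le hk.norm hf.norm))

/-- Pythagoras: the mean and the fluctuation are orthogonal. -/
theorem integral_sub_average_sq {Ω : Set α} {w : α → ℝ} (hΩ : μ Ω ≠ ⊤)
    (hw : MemLp w 2 (μ.restrict Ω)) :
    ∫ x in Ω, (w x - ⨍ y in Ω, w y ∂μ) ^ 2 ∂μ =
      (∫ x in Ω, w x ^ 2 ∂μ) - μ.real Ω * (⨍ y in Ω, w y ∂μ) ^ 2 := by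
  have : IsFiniteMeasure (μ.restrict Ω) := ⟨by simpa using hΩ.lt_top⟩
  set m := ⨍ y in Ω, w y ∂μ with hm
  have hmean : ∫ x in Ω, w x ∂μ = μ.real Ω * m := by
    rw [hm, setAverage_eq, smul_eq_mul]
    by_cases h : μ.real Ω = 0
    · have h0 : μ Ω = 0 := by
        rcases (ENNReal.toReal_eq_zero_iff _).1 h with h | h
        · exact h
        · exact absurd h hΩ
      rw [h, Measure.restrict_eq_zero.2 h0]; simp
    · field_simp
  have e : ∀ x, (w x - m) ^ 2 = w x ^ 2 - 2 * m * w x + m ^ 2 := fun x => by ring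
  have i1 := hw.integrable_sq
  have i2 : Integrable (fun x => 2 * m * w x) (μ.restrict Ω) := (hw.integrable one_le_two).const_mul _
  have i12 : Integrable (fun x => w x ^ 2 - 2 * m * w x) (μ.restrict Ω) := i1.sub i2
  simp only [e]
  rw [integral_add i12 (integrable_const _), integral_sub i1 i2, integral_const_mul, hmean,
    setIntegral_const, smul_eq_mul]
  ring

end L2

theorem Continuous.memLp_restrict_of_isBounded {n : ℕ} {F : Type*} [NormedAddCommGroup F]
    {f : EuclideanSpace ℝ (Fin n) → F} (hf : Continuous f) {K : Set (EuclideanSpace ℝ (Fin n))}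
    (hK : MeasurableSet K) (hb : Bornology.IsBounded K) (p : ℝ≥0∞) :
    MemLp f p (volume.restrict K) := by
  have : IsFiniteMeasure (volume.restrict K) := ⟨by simpa using hb.measure_lt_top⟩
  obtain ⟨C, hC⟩ := hb.isCompact_closure.exists_bound_of_continuousOn hf.continuousOn
  exact MemLp.of_bound hf.aestronglyMeasurable C
    ((ae_restrict_mem hK).mono fun x hx => hC x (subset_closure hx))

theorem norm_gradient_eq {n : ℕ} (φ : EuclideanSpace ℝ (Fin n) → ℝ) (x : EuclideanSpace ℝ (Fin n)) :
    ‖gradient φ x‖ = ‖fderiv ℝ φ x‖ := by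
  rw [gradient, LinearIsometryEquiv.norm_map]

theorem gradient_apply_eq {n : ℕ} (φ : EuclideanSpace ℝ (Fin n) → ℝ) (x : EuclideanSpace ℝ (Fin n))
    (i : Fin n) : gradient φ x i = fderiv ℝ φ x (EuclideanSpace.single i 1) := by
  rw [← InnerProductSpace.toDual_symm_apply (𝕜 := ℝ), ← gradient, EuclideanSpace.inner_single_right]
  simp

theorem continuous_horizontal : Continuous horizontal := by
  unfold horizontal; fun_prop

/-! ### The two weights on a prism and the base identity -/

/-- The reciprocal of the height of a prism, as a function on space. -/
noncomputable def heightInv (Γ : Set (EuclideanSpace ℝ (Fin 2))) (H : EuclideanSpace ℝ (Fin 2) → ℝ)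
    (x : EuclideanSpace ℝ (Fin 3)) : ℝ := (Γ.indicator H (horizontal x))⁻¹

/-- The function on a prism that falls linearly from `1` on the base to `0` on the top. -/
noncomputable def ramp (Γ : Set (EuclideanSpace ℝ (Fin 2))) (H : EuclideanSpace ℝ (Fin 2) → ℝ)
    (x : EuclideanSpace ℝ (Fin 3)) : ℝ := 1 - x 2 * heightInv Γ H x

section Prism

variable {Γ : Set (EuclideanSpace ℝ (Fin 2))} {H : EuclideanSpace ℝ (Fin 2) → ℝ} {Hmin : ℝ}

theorem heightInv_spaceEquiv {y : EuclideanSpace ℝ (Fin 2)} (hy : y ∈ Γ) (z : ℝ) :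
    heightInv Γ H (spaceEquiv (y, z)) = (H y)⁻¹ := by
  rw [heightInv, horizontal_spaceEquiv, Set.indicator_of_mem hy]

theorem ramp_spaceEquiv {y : EuclideanSpace ℝ (Fin 2)} (hy : y ∈ Γ) (z : ℝ) :
    ramp Γ H (spaceEquiv (y, z)) = 1 - z / H y := by
  rw [ramp, heightInv_spaceEquiv hy, spaceEquiv_apply_two, div_eq_mul_inv]

/-- The set is the union of the horizontal slices of the open prism above level `a`. This yields the
openness of `Γ` and the measurability of `H` on `Γ`, neither of which is assumed. -/
theorem isOpen_setOf_lt_height (ho : IsOpen (prism Γ H)) {a : ℝ} (ha : 0 ≤ a) :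
    IsOpen {y | y ∈ Γ ∧ a < H y} := by
  have : {y | y ∈ Γ ∧ a < H y} = ⋃ z ∈ Set.Ioi a, (fun y => spaceEquiv (y, z)) ⁻¹' prism Γ H := by
    ext y
    simp only [Set.mem_ofPred_eq, Set.mem_iUnion, Set.mem_preimage, spaceEquiv_mem_prism, Set.mem_Ioi,
      Set.mem_Ioo, exists_prop]
    constructor
    · rintro ⟨hy, h⟩
      obtain ⟨z, hz, hz'⟩ := exists_between h
      exact ⟨z, hz, hy, ha.trans_lt hz, hz'⟩
    · rintro ⟨z, hz, hy, -, hz'⟩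
      exact ⟨hy, hz.trans hz'⟩
  rw [this]
  exact isOpen_biUnion fun z _ => ho.preimage (continuous_spaceEquiv.comp (by fun_prop))

theorem isOpen_base (hmin : 0 < Hmin) (hH : ∀ y ∈ Γ, Hmin ≤ H y) (ho : IsOpen (prism Γ H)) :
    IsOpen Γ := by
  have := isOpen_setOf_lt_height ho le_rfl
  convert this using 1
  ext y
  exact ⟨fun hy => ⟨hy, hmin.trans_le (hH y hy)⟩, fun h => h.1⟩

theorem mem_prism_half (hmin : 0 < Hmin) (hH : ∀ y ∈ Γ, Hmin ≤ H y) {y : EuclideanSpace ℝ (Fin 2)}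
    (hy : y ∈ Γ) : spaceEquiv (y, H y / 2) ∈ prism Γ H := by
  have := hmin.trans_le (hH y hy)
  exact spaceEquiv_mem_prism.2 ⟨hy, by linarith, by linarith⟩

theorem isBounded_base (hmin : 0 < Hmin) (hH : ∀ y ∈ Γ, Hmin ≤ H y)
    (hb : Bornology.IsBounded (prism Γ H)) : Bornology.IsBounded Γ := by
  refine (hb.isCompact_closure.image continuous_horizontal).isBounded.subset fun y hy => ?_
  exact ⟨_, subset_closure (mem_prism_half hmin hH hy), horizontal_spaceEquiv _ _⟩

theorem measurable_indicator_height (hmin : 0 < Hmin) (hH : ∀ y ∈ Γ, Hmin ≤ H y)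
    (ho : IsOpen (prism Γ H)) : Measurable (Γ.indicator H) := by
  refine measurable_of_Ioi fun a => ?_
  rcases lt_or_ge a 0 with ha | ha
  · have : Γ.indicator H ⁻¹' Set.Ioi a = Set.univ := by
      refine Set.eq_univ_of_forall fun y => ?_
      exact ha.trans_le (Set.indicator_nonneg (fun y hy => (hmin.trans_le (hH y hy)).le) y)
    rw [this]; exact MeasurableSet.univ
  · have : Γ.indicator H ⁻¹' Set.Ioi a = {y | y ∈ Γ ∧ a < H y} := by
      ext y
      by_cases hy : y ∈ Γ <;> simp [hy, ha]
    rw [this]; exact (isOpen_setOf_lt_height ho ha).measurableSet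

theorem measurable_heightInv (hmin : 0 < Hmin) (hH : ∀ y ∈ Γ, Hmin ≤ H y)
    (ho : IsOpen (prism Γ H)) : Measurable (heightInv Γ H) :=
  ((measurable_indicator_height hmin hH ho).comp continuous_horizontal.measurable).inv

theorem measurable_ramp (hmin : 0 < Hmin) (hH : ∀ y ∈ Γ, Hmin ≤ H y)
    (ho : IsOpen (prism Γ H)) : Measurable (ramp Γ H) := by
  have h1 : Continuous fun x : EuclideanSpace ℝ (Fin 3) => x 2 := by fun_prop
  exact measurable_const.sub (h1.measurable.mul (measurable_heightInv hmin hH ho))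

theorem memLp_heightInv (hmin : 0 < Hmin) (hH : ∀ y ∈ Γ, Hmin ≤ H y) (ho : IsOpen (prism Γ H))
    (hb : Bornology.IsBounded (prism Γ H)) (p : ℝ≥0∞) :
    MemLp (heightInv Γ H) p (volume.restrict (prism Γ H)) := by
  have : IsFiniteMeasure (volume.restrict (prism Γ H)) := ⟨by simpa using hb.measure_lt_top⟩
  refine MemLp.of_bound (measurable_heightInv hmin hH ho).aestronglyMeasurable Hmin⁻¹
    ((ae_restrict_mem ho.measurableSet).mono fun x hx => ?_)
  obtain ⟨⟨y, z⟩, rfl⟩ := spaceEquiv.surjective x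
  have hy := (spaceEquiv_mem_prism.1 hx).1
  have hp := hmin.trans_le (hH y hy)
  rw [heightInv_spaceEquiv hy, Real.norm_of_nonneg (inv_pos.2 hp).le]
  exact inv_anti₀ hmin (hH y hy)

theorem memLp_ramp (hmin : 0 < Hmin) (hH : ∀ y ∈ Γ, Hmin ≤ H y) (ho : IsOpen (prism Γ H))
    (hb : Bornology.IsBounded (prism Γ H)) (p : ℝ≥0∞) :
    MemLp (ramp Γ H) p (volume.restrict (prism Γ H)) := by
  have : IsFiniteMeasure (volume.restrict (prism Γ H)) := ⟨by simpa using hb.measure_lt_top⟩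
  refine MemLp.of_bound (measurable_ramp hmin hH ho).aestronglyMeasurable 1
    ((ae_restrict_mem ho.measurableSet).mono fun x hx => ?_)
  obtain ⟨⟨y, z⟩, rfl⟩ := spaceEquiv.surjective x
  obtain ⟨hy, hz⟩ := spaceEquiv_mem_prism.1 hx
  have hp := hmin.trans_le (hH y hy)
  have h1 : 0 < z / H y := div_pos hz.1 hp
  have h2 : z / H y < 1 := (div_lt_one hp).2 hz.2
  rw [ramp_spaceEquiv hy, Real.norm_eq_abs, abs_le]
  constructor <;> linarith

theorem setIntegral_prism_eq (hmin : 0 < Hmin) (hH : ∀ y ∈ Γ, Hmin ≤ H y)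
    (ho : IsOpen (prism Γ H)) {u : EuclideanSpace ℝ (Fin 3) → ℝ} (hu : IntegrableOn u (prism Γ H))
    {v : EuclideanSpace ℝ (Fin 2) → ℝ}
    (huv : ∀ y ∈ Γ, ∫ z in (0 : ℝ)..H y, u (spaceEquiv (y, z)) = v y) :
    ∫ x in prism Γ H, u x = ∫ y in Γ, v y := by
  have hΓ := (isOpen_base hmin hH ho).measurableSet
  rw [setIntegral_prism ho.measurableSet hΓ hu]
  refine setIntegral_congr_fun hΓ fun y hy => ?_
  have h := huv y hy
  rwa [intervalIntegral.integral_of_le (hmin.trans_le (hH y hy)).le,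
    integral_Ioc_eq_integral_Ioo] at h

theorem volume_real_prism (hmin : 0 < Hmin) (hH : ∀ y ∈ Γ, Hmin ≤ H y) (ho : IsOpen (prism Γ H))
    (hb : Bornology.IsBounded (prism Γ H)) : volume.real (prism Γ H) = ∫ y in Γ, H y := by
  have h1 : IntegrableOn (fun _ => (1 : ℝ)) (prism Γ H) := by
    rw [integrableOn_const_iff]; exact Or.inr hb.measure_lt_top
  rw [← setIntegral_prism_eq hmin hH ho h1 (v := H) fun y _ => by simp]
  simp

/-- Each fibre has length `H` and contributes exactly `1`. -/
theorem setIntegral_heightInv (hmin : 0 < Hmin) (hH : ∀ y ∈ Γ, Hmin ≤ H y)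
    (ho : IsOpen (prism Γ H)) (hb : Bornology.IsBounded (prism Γ H)) :
    ∫ x in prism Γ H, heightInv Γ H x = volume.real Γ := by
  rw [setIntegral_prism_eq hmin hH ho (v := fun _ => 1)
    (memLp_one_iff_integrable.1 (memLp_heightInv hmin hH ho hb 1))]
  · simp
  · intro y hy
    simp only [heightInv_spaceEquiv hy]
    simp [(hmin.trans_le (hH y hy)).ne']

/-- Only one factor `1 / H` is estimated by `1 / Hmin`; the other is integrated exactly. This is
where `κ` comes from. -/
theorem setIntegral_heightInv_sq_le (hmin : 0 < Hmin) (hH : ∀ y ∈ Γ, Hmin ≤ H y)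
    (ho : IsOpen (prism Γ H)) (hb : Bornology.IsBounded (prism Γ H)) :
    ∫ x in prism Γ H, heightInv Γ H x ^ 2 ≤ volume.real Γ / Hmin := by
  have hm := memLp_heightInv hmin hH ho hb
  have h1 : ∫ x in prism Γ H, heightInv Γ H x ^ 2 ≤ ∫ x in prism Γ H, Hmin⁻¹ * heightInv Γ H x := by
    refine setIntegral_mono_on (hm 2).integrable_sq
      ((memLp_one_iff_integrable.1 (hm 1)).const_mul _) ho.measurableSet fun x hx => ?_
    obtain ⟨⟨y, z⟩, rfl⟩ := spaceEquiv.surjective x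
    have hy := (spaceEquiv_mem_prism.1 hx).1
    have hp := hmin.trans_le (hH y hy)
    rw [heightInv_spaceEquiv hy, sq]
    exact mul_le_mul_of_nonneg_right (inv_anti₀ hmin (hH y hy)) (inv_pos.2 hp).le
  rw [integral_const_mul, setIntegral_heightInv hmin hH ho hb] at h1
  rwa [div_eq_inv_mul]

/-- The fibre over `y` contributes `H y / 3`, the origin of the `√3` in the result. -/
theorem setIntegral_ramp_sq (hmin : 0 < Hmin) (hH : ∀ y ∈ Γ, Hmin ≤ H y)
    (ho : IsOpen (prism Γ H)) (hb : Bornology.IsBounded (prism Γ H)) :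
    ∫ x in prism Γ H, ramp Γ H x ^ 2 = volume.real (prism Γ H) / 3 := by
  rw [setIntegral_prism_eq hmin hH ho (v := fun y => H y / 3)
    (memLp_ramp hmin hH ho hb 2).integrable_sq, integral_div, volume_real_prism hmin hH ho hb]
  intro y hy
  have hp := (hmin.trans_le (hH y hy)).ne'
  simp only [ramp_spaceEquiv hy]
  have hd : ∀ z ∈ Set.uIcc 0 (H y), HasDerivAt (fun z => -(H y / 3) * (1 - z / H y) ^ 3)
      ((1 - z / H y) ^ 2) z := by
    intro z _
    have h1 := ((((hasDerivAt_id z).div_const (H y)).const_sub 1).fun_pow 3).const_mul (-(H y / 3))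
    refine h1.congr_deriv ?_
    have h2 : -(H y / 3) * (3 * (1 - z / H y) ^ 2 * -(1 / H y)) = (1 - z / H y) ^ 2 := by
      rw [show -(H y / 3) * (3 * (1 - z / H y) ^ 2 * -(1 / H y)) =
        (H y * (1 / H y)) * (1 - z / H y) ^ 2 by ring, mul_one_div_cancel hp, one_mul]
    simpa using h2
  rw [intervalIntegral.integral_eq_sub_of_hasDerivAt hd
    (Continuous.intervalIntegrable (by fun_prop) _ _)]
  simp [div_self hp]

/-- The base integral of a smooth function as an integral over the prism. -/
theorem setIntegral_base_eq (hmin : 0 < Hmin) (hH : ∀ y ∈ Γ, Hmin ≤ H y)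
    (ho : IsOpen (prism Γ H)) (hb : Bornology.IsBounded (prism Γ H))
    {φ : EuclideanSpace ℝ (Fin 3) → ℝ} (hφ : ContDiff ℝ 1 φ) :
    ∫ y in Γ, φ (onBase y) = (∫ x in prism Γ H, heightInv Γ H x * φ x) -
      ∫ x in prism Γ H, ramp Γ H x * gradient φ x 2 := by
  have hφc := hφ.continuous
  have hφ'c : Continuous (fderiv ℝ φ) := hφ.continuous_fderiv one_ne_zero
  have hgc : Continuous fun x => gradient φ x 2 := by
    simp only [gradient_apply_eq]; exact hφ'c.clm_apply continuous_const
  have i1 : IntegrableOn (fun x => heightInv Γ H x * φ x) (prism Γ H) :=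
    (memLp_heightInv hmin hH ho hb 2).integrable_mul
      (hφc.memLp_restrict_of_isBounded ho.measurableSet hb 2)
  have i2 : IntegrableOn (fun x => ramp Γ H x * gradient φ x 2) (prism Γ H) :=
    (memLp_ramp hmin hH ho hb 2).integrable_mul
      (hgc.memLp_restrict_of_isBounded ho.measurableSet hb 2)
  rw [← integral_sub i1 i2]
  refine (setIntegral_prism_eq hmin hH ho (i1.sub i2) fun y hy => ?_).symm
  have hp := (hmin.trans_le (hH y hy)).ne'
  simp only [Pi.sub_apply, heightInv_spaceEquiv hy, ramp_spaceEquiv hy, gradient_apply_eq]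
  set e3 : EuclideanSpace ℝ (Fin 3) := EuclideanSpace.single 2 1 with he3
  have hTy : Continuous fun z => spaceEquiv (y, z) := continuous_spaceEquiv.comp (by fun_prop)
  -- This primitive vanishes at the top and equals minus the base value at `z = 0`.
  have hd : ∀ z ∈ Set.uIcc 0 (H y), HasDerivAt (fun z => -((1 - z / H y) * φ (spaceEquiv (y, z))))
      ((H y)⁻¹ * φ (spaceEquiv (y, z)) - (1 - z / H y) * fderiv ℝ φ (spaceEquiv (y, z)) e3) z := by
    intro z _
    have h1 : HasDerivAt (fun z => spaceEquiv (y, z)) e3 z := by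
      have h2 := ((hasDerivAt_id z).smul_const e3).const_add (baseIsometry y)
      rw [one_smul] at h2
      refine h2.congr_of_eventuallyEq (Eventually.of_forall fun z => ?_)
      exact spaceEquiv_eq_add y z
    have h3 : HasDerivAt (fun z => φ (spaceEquiv (y, z))) (fderiv ℝ φ (spaceEquiv (y, z)) e3) z :=
      (hφ.differentiable one_ne_zero _).hasFDerivAt.comp_hasDerivAt z h1
    have h4 := ((((hasDerivAt_id z).div_const (H y)).const_sub 1).fun_mul h3).fun_neg
    refine h4.congr_deriv ?_
    simp only [id, one_div]
    ring
  have hcont : Continuous fun z => (H y)⁻¹ * φ (spaceEquiv (y, z)) -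
      (1 - z / H y) * fderiv ℝ φ (spaceEquiv (y, z)) e3 := by
    have h1 := hφc.comp hTy
    have h2 := (hφ'c.comp hTy).clm_apply (continuous_const (y := e3))
    exact (h1.const_mul _).sub ((by fun_prop : Continuous fun z => 1 - z / H y).mul h2)
  rw [intervalIntegral.integral_eq_sub_of_hasDerivAt hd (hcont.intervalIntegrable _ _)]
  have h0 : spaceEquiv (y, 0) = onBase y := by
    rw [spaceEquiv_apply]; rfl
  simp [div_self hp, h0]

end Prism

/-! ### The trace identity and the boundary Poincaré inequality -/

section Trace

variable {Γ : Set (EuclideanSpace ℝ (Fin 2))} {H : EuclideanSpace ℝ (Fin 2) → ℝ} {Hmin : ℝ}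
  {w : EuclideanSpace ℝ (Fin 3) → ℝ} {G : EuclideanSpace ℝ (Fin 3) → EuclideanSpace ℝ (Fin 3)}
  {g : EuclideanSpace ℝ (Fin 2) → ℝ}

theorem ContDiff.continuous_gradient {n : ℕ} {φ : EuclideanSpace ℝ (Fin n) → ℝ}
    (hφ : ContDiff ℝ ∞ φ) : Continuous (gradient φ) :=
  (InnerProductSpace.toDual ℝ _).symm.continuous.comp (hφ.continuous_fderiv (by simp))

theorem MeasureTheory.MemLp.euclidean_apply {α : Type*} [MeasurableSpace α] {μ : Measure α} {n : ℕ}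
    {F : α → EuclideanSpace ℝ (Fin n)} {p : ℝ≥0∞} (hF : MemLp F p μ) (i : Fin n) :
    MemLp (fun x => F x i) p μ := by
  refine hF.mono ?_ (Eventually.of_forall fun x => PiLp.norm_apply_le _ _)
  exact (by fun_prop : Continuous fun v : EuclideanSpace ℝ (Fin n) => v i).comp_aestronglyMeasurable
    hF.aestronglyMeasurable

/-- The integral of the base trace as an integral over the prism. -/
theorem IsBaseTrace.setIntegral_eq (hmin : 0 < Hmin) (hH : ∀ y ∈ Γ, Hmin ≤ H y)
    (ho : IsOpen (prism Γ H)) (hb : Bornology.IsBounded (prism Γ H))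
    (hw : MemLp w 2 (volume.restrict (prism Γ H))) (hG : MemLp G 2 (volume.restrict (prism Γ H)))
    (htr : IsBaseTrace (prism Γ H) Γ w G g) :
    ∫ y in Γ, g y = (∫ x in prism Γ H, heightInv Γ H x * w x) -
      ∫ x in prism Γ H, ramp Γ H x * G x 2 := by
  obtain ⟨hg, φ, hφ, h1, h2, h3⟩ := htr
  have hΓo := isOpen_base hmin hH ho
  have hΓb := isBounded_base hmin hH hb
  have hgr : ∀ k, MemLp (gradient (φ k)) 2 (volume.restrict (prism Γ H)) := fun k =>
    (hφ k).continuous_gradient.memLp_restrict_of_isBounded ho.measurableSet hb 2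
  have hbase : ∀ k, MemLp (fun y => φ k (onBase y)) 2 (volume.restrict Γ) := fun k =>
    ((hφ k).continuous.comp baseIsometry.continuous).memLp_restrict_of_isBounded
      hΓo.measurableSet hΓb 2
  have : IsFiniteMeasure (volume.restrict Γ) := ⟨by simpa using hΓb.measure_lt_top⟩
  -- All three integrals in the identity are pairings with a fixed square-integrable function, hence
  -- continuous under the convergences in the definition of the trace.
  have t1 := tendsto_integral_mul_of_tendsto_eLpNorm
    (fun k => (hφ k).continuous.memLp_restrict_of_isBounded ho.measurableSet hb 2) hw
    (memLp_heightInv hmin hH ho hb 2) h1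
  have t2 := tendsto_integral_mul_of_tendsto_eLpNorm (F := fun k x => gradient (φ k) x 2)
    (f := fun x => G x 2) (fun k => (hgr k).euclidean_apply 2) (hG.euclidean_apply 2)
    (memLp_ramp hmin hH ho hb 2)
    (tendsto_of_tendsto_of_tendsto_of_le_of_le tendsto_const_nhds h2 (fun _ => zero_le)
      fun k => eLpNorm_mono fun x => PiLp.norm_apply_le (gradient (φ k) x - G x) 2)
  have t3 := tendsto_integral_mul_of_tendsto_eLpNorm hbase hg (memLp_const (1 : ℝ)) h3
  simp only [one_mul] at t3
  refine tendsto_nhds_unique t3 ((t1.sub t2).congr fun k => ?_)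
  exact (setIntegral_base_eq hmin hH ho hb ((hφ k).of_le (by simp))).symm

/-- The boundary Poincaré inequality on a prism, for a function with a Poincaré inequality. -/
theorem boundary_poincare_of_poincare (hmin : 0 < Hmin) (hH : ∀ y ∈ Γ, Hmin ≤ H y)
    (ho : IsOpen (prism Γ H)) (hb : Bornology.IsBounded (prism Γ H)) (hne : (prism Γ H).Nonempty)
    (hw : MemLp w 2 (volume.restrict (prism Γ H))) (hG : MemLp G 2 (volume.restrict (prism Γ H)))
    (htr : IsBaseTrace (prism Γ H) Γ w G g) (hg : ⨍ y in Γ, g y = 0) {c : ℝ} (hc : 0 ≤ c)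
    (hP : ∫ x in prism Γ H, (w x - ⨍ x in prism Γ H, w x) ^ 2 ≤
      c ^ 2 * ∫ x in prism Γ H, ‖G x‖ ^ 2) :
    ∫ x in prism Γ H, w x ^ 2 ≤
      (c ^ 2 + ((⨍ y in Γ, H y) / √3 + c * √((⨍ y in Γ, H y) / Hmin - 1)) ^ 2) *
        ∫ x in prism Γ H, ‖G x‖ ^ 2 := by
  have hΓo := isOpen_base hmin hH ho
  have hΓb := isBounded_base hmin hH hb
  have hΓne : Γ.Nonempty := by
    obtain ⟨x, hx⟩ := hne
    exact ⟨_, hx.1⟩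
  have : IsFiniteMeasure (volume.restrict (prism Γ H)) := ⟨by simpa using hb.measure_lt_top⟩
  have hmean := integral_sub_average_sq hb.measure_lt_top.ne hw
  set Ω := prism Γ H with hΩ
  set V := volume.real Ω with hV
  set A := volume.real Γ with hA
  have hV0 : 0 < V := ENNReal.toReal_pos (ho.measure_pos _ hne).ne' hb.measure_lt_top.ne
  have hA0 : 0 < A := ENNReal.toReal_pos (hΓo.measure_pos _ hΓne).ne' hΓb.measure_lt_top.ne
  have hHavg : ⨍ y in Γ, H y = V / A := by
    rw [setAverage_eq, ← volume_real_prism hmin hH ho hb, smul_eq_mul, ← hA, div_eq_inv_mul]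
  have hg0 : ∫ y in Γ, g y = 0 := by
    rw [setAverage_eq, smul_eq_mul] at hg
    exact (mul_eq_zero.1 hg).resolve_left (inv_ne_zero hA0.ne')
  set m := ⨍ x in Ω, w x with hm
  have hwm : ∫ x in Ω, w x = V * m := by
    rw [hm, setAverage_eq, smul_eq_mul, mul_inv_cancel_left₀ hV0.ne']
  set N := ∫ x in Ω, ‖G x‖ ^ 2 with hN
  have hN0 : 0 ≤ N := integral_nonneg fun x => sq_nonneg _
  have hid := htr.setIntegral_eq hmin hH ho hb hw hG
  rw [hg0] at hid
  have hψ1 := memLp_heightInv hmin hH ho hb 2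
  have hψ2 := memLp_ramp hmin hH ho hb 2
  have hψ1i := hψ1.integrable one_le_two
  have hwi := hw.integrable one_le_two
  -- `A / V` is the mean of `1 / H` over the prism. Removing it costs nothing against `w - m` and
  -- makes `ψ` vanish when `H` is constant on `Γ`.
  set ψ : EuclideanSpace ℝ (Fin 3) → ℝ := fun x => heightInv Γ H x - A / V with hψ
  have hψL : MemLp ψ 2 (volume.restrict Ω) := hψ1.sub (memLp_const _)
  have hwL : MemLp (fun x => w x - m) 2 (volume.restrict Ω) := hw.sub (memLp_const _)
  have hψw : ∫ x in Ω, ψ x * (w x - m) = (∫ x in Ω, heightInv Γ H x * w x) - m * A := by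
    have e : ∀ x, ψ x * (w x - m) =
        (heightInv Γ H x * w x - m * heightInv Γ H x) - (A / V * w x - A / V * m) := fun x => by
      simp only [hψ]; ring
    have i1 : IntegrableOn (fun x => heightInv Γ H x * w x) Ω := hψ1.integrable_mul hw
    have i2 : IntegrableOn (fun x => m * heightInv Γ H x) Ω := hψ1i.const_mul _
    have i3 : IntegrableOn (fun x => A / V * w x) Ω := hwi.const_mul _
    have i4 : IntegrableOn (fun _ : EuclideanSpace ℝ (Fin 3) => A / V * m) Ω := integrable_const _
    have i12 : IntegrableOn (fun x => heightInv Γ H x * w x - m * heightInv Γ H x) Ω := i1.sub i2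
    have i34 : IntegrableOn (fun x => A / V * w x - A / V * m) Ω := i3.sub i4
    simp only [e]
    rw [integral_sub i12 i34, integral_sub i1 i2, integral_sub i3 i4, integral_const_mul,
      integral_const_mul, setIntegral_heightInv hmin hH ho hb, hwm, setIntegral_const, smul_eq_mul,
      ← hV, ← hA]
    ring
  have hψψ : ∫ x in Ω, ψ x ^ 2 ≤ A / Hmin - A ^ 2 / V := by
    have e : ∀ x, ψ x ^ 2 =
        (heightInv Γ H x ^ 2 - 2 * (A / V) * heightInv Γ H x) + (A / V) ^ 2 := fun x => by
      simp only [hψ]; ring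
    have i1 : IntegrableOn (fun x => heightInv Γ H x ^ 2) Ω := hψ1.integrable_sq
    have i2 : IntegrableOn (fun x => 2 * (A / V) * heightInv Γ H x) Ω := hψ1i.const_mul _
    have i12 : IntegrableOn (fun x => heightInv Γ H x ^ 2 - 2 * (A / V) * heightInv Γ H x) Ω :=
      i1.sub i2
    simp only [e]
    rw [integral_add i12 (integrable_const _), integral_sub i1 i2, integral_const_mul,
      setIntegral_heightInv hmin hH ho hb, setIntegral_const, smul_eq_mul, ← hV, ← hA]
    have h1 := setIntegral_heightInv_sq_le hmin hH ho hb
    rw [← hA] at h1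
    have h2 : V * (A / V) ^ 2 - 2 * (A / V) * A = - (A ^ 2 / V) := by field_simp; ring
    linarith
  set k := √(V / A / Hmin - 1) with hk
  -- That the argument of the root is non-negative is read off from `∫ ψ² ≥ 0`.
  have hk2 : k ^ 2 = V / A / Hmin - 1 := by
    refine Real.sq_sqrt ?_
    have h1 : 0 ≤ A / Hmin - A ^ 2 / V := (integral_nonneg fun x => sq_nonneg _).trans hψψ
    have h2 : V / A / Hmin - 1 = V / A ^ 2 * (A / Hmin - A ^ 2 / V) := by field_simp
    rw [h2]; positivity
  have hk0 : 0 ≤ k := Real.sqrt_nonneg _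
  set s := √V with hs
  have hs0 : 0 < s := Real.sqrt_pos.2 hV0
  have hs2 : s ^ 2 = V := Real.sq_sqrt hV0.le
  set n := √N with hn
  have hn0 : 0 ≤ n := Real.sqrt_nonneg _
  have hn2 : n ^ 2 = N := Real.sq_sqrt hN0
  have h3 : (0 : ℝ) < √3 := by positivity
  have h32 : √3 ^ 2 = (3 : ℝ) := Real.sq_sqrt (by norm_num)
  have b1 : |∫ x in Ω, ramp Γ H x * G x 2| ≤ s / √3 * n := by
    refine abs_le_of_sq_le_sq ((sq_integral_mul_le hψ2 (hG.euclidean_apply 2)).trans ?_)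
      (by positivity)
    rw [setIntegral_ramp_sq hmin hH ho hb, mul_pow, div_pow, hs2, h32, hn2]
    refine mul_le_mul_of_nonneg_left ?_ (by positivity)
    refine integral_mono (hG.euclidean_apply 2).integrable_sq hG.integrable_norm_sq fun x => ?_
    have := PiLp.norm_apply_le (G x) 2
    rw [Real.norm_eq_abs] at this
    simp only
    rw [← sq_abs]
    gcongr
  have b2 : |∫ x in Ω, ψ x * (w x - m)| ≤ A / s * k * c * n := by
    refine abs_le_of_sq_le_sq ((sq_integral_mul_le hψL hwL).trans ?_) (by positivity)
    have h4 : (A / s * k * c * n) ^ 2 = (A / Hmin - A ^ 2 / V) * (c ^ 2 * N) := by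
      rw [mul_pow, mul_pow, mul_pow, div_pow, hk2, hs2, hn2]
      field_simp
    rw [h4]
    exact mul_le_mul hψψ hP (integral_nonneg fun x => sq_nonneg _)
      ((integral_nonneg fun x => sq_nonneg _).trans hψψ)
  -- With zero trace mean, the base identity is solved for `m`.
  have b3 : |m| * A ≤ s / √3 * n + A / s * k * c * n := by
    have h4 : m * A = (∫ x in Ω, ramp Γ H x * G x 2) - ∫ x in Ω, ψ x * (w x - m) := by
      rw [hψw]; linarith
    rw [← abs_of_pos hA0, ← abs_mul, h4, abs_of_pos hA0]
    exact (abs_sub _ _).trans (add_le_add b1 b2)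
  have b4 : s * |m| ≤ (V / A / √3 + c * k) * n := by
    have h4 : s / A * (|m| * A) = s * |m| := by field_simp
    have h5 : s / A * (s / √3 * n + A / s * k * c * n) = (V / A / √3 + c * k) * n := by
      rw [← hs2]; field_simp
    rw [← h4, ← h5]
    exact mul_le_mul_of_nonneg_left b3 (by positivity)
  have b5 : V * m ^ 2 ≤ (V / A / √3 + c * k) ^ 2 * N := by
    have h4 := pow_le_pow_left₀ (by positivity) b4 2
    rwa [mul_pow, mul_pow, hs2, sq_abs, hn2] at h4
  rw [hHavg, ← hk]
  have : ∫ x in Ω, w x ^ 2 = (∫ x in Ω, (w x - m) ^ 2) + V * m ^ 2 := by rw [hmean]; ring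
  rw [this, add_mul]
  exact add_le_add hP b5

end Trace

/-! ### Subtracting constants and attaining the Poincaré constant -/

section H1

variable {n : ℕ} {Ω : Set (EuclideanSpace ℝ (Fin n))} {w : EuclideanSpace ℝ (Fin n) → ℝ}
  {G : EuclideanSpace ℝ (Fin n) → EuclideanSpace ℝ (Fin n)}

/-- Integration by parts against the constant `1`; hence constants have zero weak gradient. -/
theorem integral_fderiv_apply_eq_zero {φ : EuclideanSpace ℝ (Fin n) → ℝ} (hφ : ContDiff ℝ ∞ φ)
    (hs : HasCompactSupport φ) (v : EuclideanSpace ℝ (Fin n)) : ∫ x, fderiv ℝ φ x v = 0 := by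
  have h1 : Continuous fun x => fderiv ℝ φ x v :=
    (hφ.continuous_fderiv (by simp)).clm_apply continuous_const
  have h2 : Integrable fun x => fderiv ℝ φ x v :=
    h1.integrable_of_hasCompactSupport (hs.fderiv_apply ℝ v)
  have h := integral_mul_fderiv_eq_neg_fderiv_mul_of_integrable (μ := volume) (𝕜 := ℝ) (v := v)
    (f := fun _ => (1 : ℝ)) (g := φ) (by simp) (by simpa using h2)
    (by simpa using hφ.continuous.integrable_of_hasCompactSupport hs)
    (fun x _ => differentiableAt_const _) (fun x _ => hφ.differentiable (by simp) x)
  simpa using h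

theorem IsH1.sub_const (ho : IsOpen Ω) (hb : Bornology.IsBounded Ω) (h : IsH1 Ω w G) (m : ℝ) :
    IsH1 Ω (fun x => w x - m) G := by
  have : IsFiniteMeasure (volume.restrict Ω) := ⟨by simpa using hb.measure_lt_top⟩
  refine ⟨h.1.sub (memLp_const m), h.2.1, fun φ hφ hs hsub i => ?_⟩
  have hc : Continuous fun x => fderiv ℝ φ x (EuclideanSpace.single i 1) :=
    (hφ.continuous_fderiv (by simp)).clm_apply continuous_const
  have hL := hc.memLp_restrict_of_isBounded ho.measurableSet hb 2
  have i1 : IntegrableOn (fun x => w x * fderiv ℝ φ x (EuclideanSpace.single i 1)) Ω :=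
    h.1.integrable_mul hL
  have i2 : IntegrableOn (fun x => m * fderiv ℝ φ x (EuclideanSpace.single i 1)) Ω :=
    (hL.integrable one_le_two).const_mul m
  have h0 : ∫ x in Ω, fderiv ℝ φ x (EuclideanSpace.single i 1) = 0 := by
    rw [setIntegral_eq_integral_of_forall_compl_eq_zero, integral_fderiv_apply_eq_zero hφ hs]
    intro x hx
    have h1 : x ∉ tsupport (fderiv ℝ φ) := fun hx' => hx (hsub (tsupport_fderiv_subset ℝ hx'))
    rw [image_eq_zero_of_notMem_tsupport h1]; rfl
  simp only [sub_mul]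
  rw [integral_sub i1 i2, h.2.2 φ hφ hs hsub i, integral_const_mul, h0, mul_zero, sub_zero]

theorem setAverage_sub_setAverage (hΩ : volume Ω ≠ ⊤) (hw : IntegrableOn w Ω) :
    ⨍ x in Ω, (w x - ⨍ y in Ω, w y) = 0 := by
  have : IsFiniteMeasure (volume.restrict Ω) := ⟨by simpa using hΩ.lt_top⟩
  rw [setAverage_eq, integral_sub hw (integrable_const _), integral_average, sub_self, smul_zero]

/-- The Poincaré inequality holds with the Poincaré constant. -/
theorem eLpNorm_le_poincareConst_mul (hC : poincareConst Ω ≠ ⊤) (h : IsH1 Ω w G)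
    (h0 : ⨍ x in Ω, w x = 0) :
    eLpNorm w 2 (volume.restrict Ω) ≤ poincareConst Ω * eLpNorm G 2 (volume.restrict Ω) := by
  -- Some admissible constant exists because the infimum is finite. It settles the case of zero
  -- gradient norm; otherwise one divides by that norm and takes the infimum.
  obtain ⟨C₀, hC₀, -⟩ := sInf_lt_iff.1 (lt_top_iff_ne_top.2 hC)
  rcases eq_or_ne (eLpNorm G 2 (volume.restrict Ω)) 0 with hG | hG
  · have h1 := hC₀ w G h h0
    rw [hG, mul_zero] at h1 ⊢
    exact h1
  · rw [← ENNReal.div_le_iff hG h.2.1.eLpNorm_ne_top]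
    refine le_sInf fun C hC => ?_
    rw [ENNReal.div_le_iff hG h.2.1.eLpNorm_ne_top]
    exact hC w G h h0

end H1

/-! ### From integral inequalities to the constants -/

section Constants

variable {Γ : Set (EuclideanSpace ℝ (Fin 2))} {Ω : Set (EuclideanSpace ℝ (Fin 3))}

/-- The real number `√X` is admissible in the infimum. -/
theorem boundaryPoincareConst_sq_le {X : ℝ} (hX : 0 ≤ X)
    (h : ∀ w G g, IsH1 Ω w G → IsBaseTrace Ω Γ w G g → ⨍ y in Γ, g y = 0 →
      ∫ x in Ω, w x ^ 2 ≤ X * ∫ x in Ω, ‖G x‖ ^ 2) :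
    boundaryPoincareConst Ω Γ ^ 2 ≤ ENNReal.ofReal X := by
  have h1 : boundaryPoincareConst Ω Γ ≤ ENNReal.ofReal √X := by
    refine sInf_le fun w G g hw htr hg => ?_
    rw [← ENNReal.pow_le_pow_left_iff two_ne_zero, mul_pow, hw.1.eLpNorm_two_sq, hw.2.1.eLpNorm_two_sq,
      ← ENNReal.ofReal_pow (Real.sqrt_nonneg _), Real.sq_sqrt hX, ← ENNReal.ofReal_mul hX]
    refine ENNReal.ofReal_le_ofReal ?_
    simpa using h w G g hw htr hg
  calc boundaryPoincareConst Ω Γ ^ 2 ≤ ENNReal.ofReal √X ^ 2 := pow_le_pow_left₀ zero_le h1 2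
    _ = ENNReal.ofReal X := by rw [← ENNReal.ofReal_pow (Real.sqrt_nonneg _), Real.sq_sqrt hX]

theorem boundaryPoincareConst_prism_sq_le {H : EuclideanSpace ℝ (Fin 2) → ℝ} {Hmin : ℝ}
    (hmin : 0 < Hmin) (hH : ∀ y ∈ Γ, Hmin ≤ H y) (ho : IsOpen (prism Γ H))
    (hb : Bornology.IsBounded (prism Γ H)) (hne : (prism Γ H).Nonempty) :
    boundaryPoincareConst (prism Γ H) Γ ^ 2 ≤
      poincareConst (prism Γ H) ^ 2 +
        (ENNReal.ofReal ((⨍ y in Γ, H y) / √3) +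
          poincareConst (prism Γ H) * ENNReal.ofReal √((⨍ y in Γ, H y) / Hmin - 1)) ^ 2 := by
  -- An infinite `C_P` makes the right side infinite; otherwise everything is transferred to real
  -- numbers.
  by_cases hC : poincareConst (prism Γ H) = ⊤
  · rw [hC]; simp
  set c := (poincareConst (prism Γ H)).toReal with hc
  have hc0 : 0 ≤ c := ENNReal.toReal_nonneg
  have hCc : poincareConst (prism Γ H) = ENNReal.ofReal c := (ENNReal.ofReal_toReal hC).symm
  have havg : 0 ≤ ⨍ y in Γ, H y := by
    rw [setAverage_eq, smul_eq_mul, ← volume_real_prism hmin hH ho hb]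
    positivity
  have hr : poincareConst (prism Γ H) ^ 2 + (ENNReal.ofReal ((⨍ y in Γ, H y) / √3) +
      poincareConst (prism Γ H) * ENNReal.ofReal √((⨍ y in Γ, H y) / Hmin - 1)) ^ 2 =
      ENNReal.ofReal (c ^ 2 +
        ((⨍ y in Γ, H y) / √3 + c * √((⨍ y in Γ, H y) / Hmin - 1)) ^ 2) := by
    rw [hCc, ENNReal.ofReal_add (by positivity) (by positivity), ENNReal.ofReal_pow (by positivity),
      ENNReal.ofReal_pow (by positivity), ENNReal.ofReal_add (by positivity) (by positivity),
      ENNReal.ofReal_mul hc0]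
  rw [hr]
  refine boundaryPoincareConst_sq_le (by positivity) fun w G g hw htr hg => ?_
  refine boundary_poincare_of_poincare hmin hH ho hb hne hw.1 hw.2.1 htr hg hc0 ?_
  have : IsFiniteMeasure (volume.restrict (prism Γ H)) := ⟨by simpa using hb.measure_lt_top⟩
  have h1 := hw.sub_const ho hb (⨍ x in prism Γ H, w x)
  have h2 := eLpNorm_le_poincareConst_mul hC h1
    (setAverage_sub_setAverage hb.measure_lt_top.ne (hw.1.integrable one_le_two))
  rw [← ENNReal.pow_le_pow_left_iff two_ne_zero, mul_pow, h1.1.eLpNorm_two_sq,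
    h1.2.1.eLpNorm_two_sq, hCc, ← ENNReal.ofReal_pow hc0, ← ENNReal.ofReal_mul (sq_nonneg _),
    ENNReal.ofReal_le_ofReal_iff (mul_nonneg (sq_nonneg _) (integral_nonneg fun x => sq_nonneg _))] at h2
  simpa using h2

/-- The Poincaré inequality on a convex cylinder, for limits of smooth functions. -/
theorem poincare_cylinder_of_tendsto {h : ℝ} (ho : IsOpen Γ) (hc : Convex ℝ Γ)
    (hb : Bornology.IsBounded Γ) (hh : 0 < h) {w : EuclideanSpace ℝ (Fin 3) → ℝ}
    {G : EuclideanSpace ℝ (Fin 3) → EuclideanSpace ℝ (Fin 3)} {g : EuclideanSpace ℝ (Fin 2) → ℝ}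
    (hw : MemLp w 2 (volume.restrict (prism Γ fun _ => h)))
    (hG : MemLp G 2 (volume.restrict (prism Γ fun _ => h)))
    (htr : IsBaseTrace (prism Γ fun _ => h) Γ w G g) :
    ∫ x in prism Γ (fun _ => h), (w x - ⨍ x in prism Γ (fun _ => h), w x) ^ 2 ≤
      ((Metric.diam Γ ^ 2 + h ^ 2) / Real.pi ^ 2) * ∫ x in prism Γ (fun _ => h), ‖G x‖ ^ 2 := by
  obtain ⟨-, φ, hφ, h1, h2, -⟩ := htr
  have hΩo := isOpen_prism_const (h := h) ho
  have hΩb := isBounded_prism_const (h := h) hb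
  set Ω := prism Γ fun _ => h with hΩ
  have : IsFiniteMeasure (volume.restrict Ω) := ⟨by simpa using hΩb.measure_lt_top⟩
  have hL : ∀ k, MemLp (φ k) 2 (volume.restrict Ω) := fun k =>
    (hφ k).continuous.memLp_restrict_of_isBounded hΩo.measurableSet hΩb 2
  have t1 := tendsto_integral_norm_sq_of_tendsto_eLpNorm hL hw h1
  have t2 := tendsto_integral_norm_sq_of_tendsto_eLpNorm (fun k =>
    (hφ k).continuous_gradient.memLp_restrict_of_isBounded hΩo.measurableSet hΩb 2) hG h2
  have t3 := tendsto_integral_mul_of_tendsto_eLpNorm hL hw (memLp_const (1 : ℝ)) h1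
  simp only [one_mul, Real.norm_eq_abs, sq_abs] at t1 t3
  have t4 : Tendsto (fun k => ⨍ x in Ω, φ k x) atTop (𝓝 (⨍ x in Ω, w x)) := by
    simp only [setAverage_eq]; exact t3.const_smul _
  rw [integral_sub_average_sq hΩb.measure_lt_top.ne hw]
  refine le_of_tendsto_of_tendsto' (t1.sub ((t4.pow 2).const_mul _)) (t2.const_mul _) fun k => ?_
  rw [← integral_sub_average_sq hΩb.measure_lt_top.ne (hL k)]
  set m := ⨍ x in Ω, φ k x with hm
  -- Each approximation is centred by its own mean, and these means converge to that of `w` by `t4`.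
  have hsm : ContDiff ℝ 1 fun x => φ k x - m := ((hφ k).of_le (by simp)).sub contDiff_const
  have h0 : ∫ x in Ω, (φ k x - m) = 0 := by
    rw [integral_sub ((hL k).integrable one_le_two) (integrable_const _), integral_average, sub_self]
  have h3 := poincare_cylinder ho hc hb hh hsm h0
  simp only [fderiv_sub_const] at h3
  simpa only [norm_gradient_eq] using h3

/-- With `Hmin = h` the `κ` term vanishes. The general estimate is applied with `c = √K` to each
function that has a base trace, so no bound on `poincareConst` itself is needed. -/
theorem boundaryPoincareConst_cylinder_sq_le {h : ℝ} (ho : IsOpen Γ) (hne : Γ.Nonempty)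
    (hb : Bornology.IsBounded Γ) (hc : Convex ℝ Γ) (hh : 0 < h) :
    boundaryPoincareConst (prism Γ fun _ => h) Γ ^ 2 ≤
      ENNReal.ofReal ((Metric.diam Γ ^ 2 + h ^ 2) / Real.pi ^ 2 + h ^ 2 / 3) := by
  have hΩo := isOpen_prism_const (h := h) ho
  have hΩb := isBounded_prism_const (h := h) hb
  have hH : ∀ y ∈ Γ, h ≤ (fun _ : EuclideanSpace ℝ (Fin 2) => h) y := fun _ _ => le_rfl
  have hΩne : (prism Γ fun _ => h).Nonempty := by
    obtain ⟨y, hy⟩ := hne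
    exact ⟨_, mem_prism_half hh hH hy⟩
  refine boundaryPoincareConst_sq_le (by positivity) fun w G g hw htr hg => ?_
  set K := (Metric.diam Γ ^ 2 + h ^ 2) / Real.pi ^ 2 with hK
  have hK0 : 0 ≤ K := by positivity
  have h1 := poincare_cylinder_of_tendsto ho hc hb hh hw.1 hw.2.1 htr
  rw [← hK, ← Real.sq_sqrt hK0] at h1
  have h2 := boundary_poincare_of_poincare hh hH hΩo hΩb hΩne hw.1 hw.2.1 htr hg
    (Real.sqrt_nonneg _) h1
  have h3 : ⨍ _ in Γ, h = h :=
    setAverage_const (ho.measure_pos _ hne).ne' hb.measure_lt_top.ne h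
  rw [h3, div_self hh.ne', sub_self, Real.sqrt_zero, mul_zero, add_zero, Real.sq_sqrt hK0, div_pow,
    Real.sq_sqrt (by norm_num : (0 : ℝ) ≤ 3)] at h2
  exact h2

end Constants

theorem mainTheorem9 :
    (∀ (Γ : Set (EuclideanSpace ℝ (Fin 2))) (H : EuclideanSpace ℝ (Fin 2) → ℝ) (Hmin : ℝ),
      0 < Hmin → (∀ y ∈ Γ, Hmin ≤ H y) → IsLipschitzDomain (prism Γ H) →
      boundaryPoincareConst (prism Γ H) Γ ^ 2 ≤
        poincareConst (prism Γ H) ^ 2 +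
          (ENNReal.ofReal ((⨍ y in Γ, H y) / Real.sqrt 3) +
            poincareConst (prism Γ H) *
              ENNReal.ofReal (Real.sqrt ((⨍ y in Γ, H y) / Hmin - 1))) ^ 2) ∧
    (∀ (Γ : Set (EuclideanSpace ℝ (Fin 2))) (h : ℝ),
      IsOpen Γ → Γ.Nonempty → Bornology.IsBounded Γ → Convex ℝ Γ → 0 < h →
      boundaryPoincareConst (prism Γ (fun _ => h)) Γ ^ 2 ≤
        ENNReal.ofReal ((Metric.diam Γ ^ 2 + h ^ 2) / Real.pi ^ 2 + h ^ 2 / 3) ∧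
      (Metric.diam Γ ^ 2 + h ^ 2) / Real.pi ^ 2 + h ^ 2 / 3 =
        1 / Real.pi ^ 2 * (Metric.diam Γ ^ 2 + (1 + Real.pi ^ 2 / 3) * h ^ 2)) := by
  refine ⟨fun Γ H Hmin hmin hH hΩ => ?_, fun Γ h ho hne hb hc hh => ⟨?_, ?_⟩⟩
  · exact boundaryPoincareConst_prism_sq_le hmin hH hΩ.1 hΩ.2.2.1 hΩ.2.1.nonempty
  · exact boundaryPoincareConst_cylinder_sq_le ho hne hb hc hh
  · have := Real.pi_ne_zero
    field_simp
    ring
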